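/- Let $P$ be a graded poset, i.e. a poset with a rank function $r:P\to\mathbb{Z}_{\ge 0}$ that is strictly increasing and satisfies $r(x)=r(y)+1$ whenever $x$ covers $y$ (written $y\lessdot x$). Regard $P$ as a category with one arrow $x\to y$ for each $x\le y$. A presheaf (resp. copresheaf) on $P$ is a functor $P^{op}\to Ab$ (resp. $P\to Ab$). Let $\mathcal{G}$ be a free copresheaf, i.e. every $\mathcal{G}(x)$ is a free abelian group. For a presheaf $\mathcal{F}$ put $$\mathcal{F}\otimes_P\mathcal{G}=\mathrm{coeq}\Big(\bigoplus_{y\le x}\mathcal{F}(x)\otimes\mathcal{G}(y)\rightrightarrows\bigoplus_{p\in P}\mathcal{F}(p)\otimes\mathcal{G}(p)\Big),$$ the two maps being $\mathcal{F}(y\le x)\otimes 1$ and $1\otimes\mathcal{G}(y\le x)$, and let $\mathrm{Tor}^P_i(-,\mathcal{G})$ be the $i$-th left derived functor of $-\otimes_P\mathcal{G}$ on the category of presheaves. Let $\delta_x\mathbb{Z}$ be the presheaf with value $\mathbb{Z}$ at $x$ and $0$ elsewhere. The pair $(P,\mathcal{G})$ is called homological cellular if $\mathrm{Tor}^P_i(\delta_x\mathbb{Z},\mathcal{G})=0$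 for all $x\in P$ and all $i\ne r(x)$. A cellular form of $(P,\mathcal{G})$ is a $P$-graded differential $\mathbb{Z}$-module $\varLambda=\bigoplus_{x\in P}\varLambda_x$ with differential $\partial$, $\partial^2=0$, such that (1) $\partial\varLambda_x\subseteq\bigoplus_{y\lessdot x}\varLambda_y$ for every $x$, so that $\varLambda_{\le x}=\bigoplus_{y\le x}\varLambda_y$, graded by rank, is a chain complex; (2) $H_n(\varLambda_{\le x})=0$ for all $x$ and all $n>0$; (3) the copresheaf $x\mapsto H_0(\varLambda_{\le x})$, with extension maps induced by the inclusions $\varLambda_{\le x}\hookrightarrow\varLambda_{\le y}$ for $x\le y$, is isomorphic to $\mathcal{G}$. Then $(P,\mathcal{G})$ is homological cellular if and only if it has a cellular form. Moreover the cellular form is unique up to isomorphism: if $\varLambda,\varLambda'$ are cellular forms of $(P,\mathcal{G})$ and $\varphi:H_0(\varLambda_{\le\bullet})\cong\mathcal{G}$, $\varphi':H_0(\varLambda'_{\le\bullet})\cong\mathcal{G}$ are any isomorphisms of copresheaves, there is exactly one isomorphism $\varPhi:\varLambda\to\varLambda'$ of $P$-graded differential modules (a family of isomorphisms $\varLambda_x\to\varLambda'_x$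 commuting with $\partial$) such that $\varphi'\circ H_0(\varPhi)=\varphi$. -/

import Mathlib

open CategoryTheory CategoryTheory.Limits Opposite
open scoped DirectSum TensorProduct

universe u

namespace PosetCellular

/-! ### Presheaves, copresheaves, tensor product and `Tor`

A poset `P` is regarded as a category with an arrow `x ⟶ y` iff `x ≤ y`.  The definitions are
written for modules over a commutative ring `R`; for `R = ℤ` they are about abelian groups. -/

/-- The category of presheaves of `R`-modules on the poset `P`. -/
abbrev PSh (R : Type) [CommRing R] (P : Type u) [PartialOrder P] := Pᵒᵖ ⥤ ModuleCat.{u} R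

/-- The category of copresheaves of `R`-modules on the poset `P`. -/
abbrev CoPSh (R : Type) [CommRing R] (P : Type u) [PartialOrder P] := P ⥤ ModuleCat.{u} R

/-- A copresheaf is free if all its values are free. -/
def CoPSh.IsFree {R : Type} [CommRing R] {P : Type u} [PartialOrder P] (G : CoPSh R P) : Prop :=
  ∀ x : P, Module.Free R (G.obj x)

/-- There are enough projective presheaves: `F` is a quotient of a coproduct of
left Kan extensions along points of projective modules covering the values of `F`. -/
instance enoughProjectives_PSh (R : Type) [CommRing R] (P : Type u) [PartialOrder P] :
    EnoughProjectives (PSh R P) where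
  presentation F :=
    let Q : Pᵒᵖ → PSh R P := fun x =>
      (evaluationLeftAdjoint (ModuleCat.{u} R) x).obj (Projective.over (F.obj x))
    let adj := fun x : Pᵒᵖ => evaluationAdjunctionRight (ModuleCat.{u} R) x
    let q : ∀ x, Q x ⟶ F := fun x => ((adj x).homEquiv _ _).symm (Projective.π (F.obj x))
    have hQ : ∀ x, Projective (Q x) := fun x =>
      (adj x).map_projective _ (Projective.projective_over _)
    ⟨{ p := ∐ Q
       projective := inferInstance
       f := Sigma.desc q
       epi := ⟨fun g h hgh => by
          ext x : 2
          have h1 : q x ≫ g = q x ≫ h := by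
            simpa using Sigma.ι Q x ≫= hgh
          have h2 := congrArg ((adj x).homEquiv _ _) h1
          rw [Adjunction.homEquiv_naturality_right, Adjunction.homEquiv_naturality_right] at h2
          simp only [q, Equiv.apply_symm_apply] at h2
          exact (cancel_epi (Projective.π (F.obj x))).1 h2⟩ }⟩

section Delta

variable {P : Type u}

open scoped Classical in
/-- The value of `δ_x R` at `y`: all of `R` if `y = x`, and zero otherwise. -/
noncomputable def deltaValue (R : Type) [CommRing R] (x y : P) : Submodule R (ULift.{u} R) :=
  if y = x then ⊤ else ⊥

open scoped Classical in
/-- The restriction map of `δ_x R` from `y` to `z`: it is the identity if `y = z = x` and it is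
zero otherwise. -/
noncomputable def deltaRes (R : Type) [CommRing R] (x y z : P) :
    deltaValue R x y →ₗ[R] deltaValue R x z :=
  if h : z = x then
    (deltaValue R x y).subtype.codRestrict _ fun a => by simp [deltaValue, h]
  else 0

lemma deltaRes_apply_coe (R : Type) [CommRing R] (x y z : P) (a : deltaValue R x y)
    [Decidable (z = x)] :
    (deltaRes R x y z a : ULift.{u} R) = if z = x then (a : ULift.{u} R) else 0 := by
  by_cases h : z = x
  · rw [if_pos h, deltaRes, dif_pos h]
    rfl
  · rw [if_neg h, deltaRes, dif_neg h]
    rfl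

lemma deltaValue_eq_zero {R : Type} [CommRing R] {x y : P} (h : y ≠ x) (a : deltaValue R x y) :
    (a : ULift.{u} R) = 0 := by
  obtain ⟨a, ha⟩ := a
  simpa [deltaValue, h] using ha

end Delta

section Tensor

variable {R : Type} [CommRing R] {P : Type u} [PartialOrder P]

open scoped Classical in
/-- The submodule of `⨁_p F(p) ⊗ G(p)` spanned by the elements `a|_y ⊗ b - a ⊗ b|^x`, where
`y ≤ x`, `a ∈ F(x)` and `b ∈ G(y)`. -/
noncomputable def tensorRel (F : PSh R P) (G : CoPSh R P) :
    Submodule R (⨁ p : P, (F.obj (op p) ⊗[R] G.obj p : Type u)) :=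
  Submodule.span R
    {t | ∃ (y x : P) (h : y ≤ x) (a : F.obj (op x)) (b : G.obj y),
      t = DirectSum.lof R P (fun p => (F.obj (op p) ⊗[R] G.obj p : Type u)) y
            ((F.map (homOfLE h).op).hom a ⊗ₜ[R] b) -
          DirectSum.lof R P (fun p => (F.obj (op p) ⊗[R] G.obj p : Type u)) x
            (a ⊗ₜ[R] (G.map (homOfLE h)).hom b)}

/-- The tensor product `F ⊗_P G`: the coequalizer of the two maps
`⨁_{y ≤ x} F(x) ⊗ G(y) ⇉ ⨁_p F(p) ⊗ G(p)` given by restriction of `F` and extension of `G`. -/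
abbrev tensorObj (F : PSh R P) (G : CoPSh R P) : Type u :=
  (⨁ p : P, (F.obj (op p) ⊗[R] G.obj p : Type u)) ⧸ tensorRel F G

/-- The map `⨁_p F(p) ⊗ G(p) → ⨁_p F'(p) ⊗ G(p)` induced by a morphism `F ⟶ F'`. -/
noncomputable def tensorSumMap {F F' : PSh R P} (f : F ⟶ F') (G : CoPSh R P) :
    (⨁ p : P, (F.obj (op p) ⊗[R] G.obj p : Type u)) →ₗ[R]
      ⨁ p : P, (F'.obj (op p) ⊗[R] G.obj p : Type u) :=
  DirectSum.lmap fun p => LinearMap.rTensor (G.obj p) (f.app (op p)).hom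

lemma tensorSumMap_rel {F F' : PSh R P} (f : F ⟶ F') (G : CoPSh R P) :
    tensorRel F G ≤ (tensorRel F' G).comap (tensorSumMap f G) := by
  classical
  refine Submodule.span_le.2 ?_
  rintro _ ⟨y, x, h, a, b, rfl⟩
  refine Submodule.subset_span ⟨y, x, h, (f.app (op x)).hom a, b, ?_⟩
  have e : (f.app (op y)).hom ((F.map (homOfLE h).op).hom a) =
      (F'.map (homOfLE h).op).hom ((f.app (op x)).hom a) :=
    congrArg (fun k => k.hom a) (f.naturality (homOfLE h).op)
  rw [map_sub, tensorSumMap]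
  rw [DirectSum.lmap_lof, DirectSum.lmap_lof]
  rw [LinearMap.rTensor_tmul, LinearMap.rTensor_tmul, e]

/-- The map `F ⊗_P G → F' ⊗_P G` induced by a morphism `F ⟶ F'`. -/
noncomputable def tensorMap {F F' : PSh R P} (f : F ⟶ F') (G : CoPSh R P) :
    tensorObj F G →ₗ[R] tensorObj F' G :=
  Submodule.mapQ _ _ (tensorSumMap f G) (tensorSumMap_rel f G)

/-- The functor `- ⊗_P G` from presheaves on `P` to `R`-modules. -/
noncomputable def tensor (G : CoPSh R P) : PSh R P ⥤ ModuleCat.{u} R where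
  obj F := ModuleCat.of R (tensorObj F G)
  map f := ModuleCat.ofHom (tensorMap f G)
  map_id F := by
    refine ModuleCat.hom_ext (LinearMap.ext fun t => ?_)
    obtain ⟨t, rfl⟩ := Submodule.Quotient.mk_surjective _ t
    simp [tensorMap, tensorSumMap]
  map_comp f g := by
    refine ModuleCat.hom_ext (LinearMap.ext fun t => ?_)
    obtain ⟨t, rfl⟩ := Submodule.Quotient.mk_surjective _ t
    simp [tensorMap, tensorSumMap, LinearMap.rTensor_comp, DirectSum.lmap_comp]

instance tensor_additive (G : CoPSh R P) : (tensor G).Additive where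
  map_add {F F'} f g := by
    refine ModuleCat.hom_ext (LinearMap.ext fun t => ?_)
    obtain ⟨t, rfl⟩ := Submodule.Quotient.mk_surjective _ t
    have : tensorSumMap (f + g) G = tensorSumMap f G + tensorSumMap g G := by
      refine LinearMap.ext fun t => DFinsupp.ext fun p => ?_
      simp [tensorSumMap, LinearMap.rTensor_add]
    simp only [tensor, tensorMap, this]
    rfl

/-- `Tor^P_n(F, G)`, the `n`-th left derived functor of `- ⊗_P G` evaluated at `F`. -/
noncomputable def Tor (n : ℕ) (F : PSh R P) (G : CoPSh R P) : ModuleCat.{u} R :=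
  ((tensor G).leftDerived n).obj F

/-- The presheaf `δ_x R` with value `R` at `x` and zero elsewhere. -/
noncomputable def delta (R : Type) [CommRing R] (x : P) : PSh R P where
  obj y := ModuleCat.of R (deltaValue R x y.unop)
  map {y z} _ := ModuleCat.ofHom (deltaRes R x y.unop z.unop)
  map_id y := by
    classical
    refine ModuleCat.hom_ext (LinearMap.ext fun a => Subtype.ext ?_)
    simp only [ModuleCat.hom_ofHom, deltaRes_apply_coe, ModuleCat.hom_id, LinearMap.id_apply]
    split_ifs with h
    · rfl
    · exact (deltaValue_eq_zero h a).symm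
  map_comp {y z w} f g := by
    classical
    refine ModuleCat.hom_ext (LinearMap.ext fun a => Subtype.ext ?_)
    simp only [ModuleCat.hom_ofHom, deltaRes_apply_coe, ModuleCat.hom_comp, LinearMap.comp_apply]
    by_cases hw : w.unop = x
    · by_cases hz : z.unop = x
      · simp [hw, hz]
      · have hy : y.unop ≠ x := fun hy =>
          hz (le_antisymm (hy ▸ leOfHom f.unop) (hw ▸ leOfHom g.unop))
        simp [hz, deltaValue_eq_zero hy a]
    · simp [hw]

/-- `(P, G)` is homological cellular if `Tor^P_i(δ_x R, G) = 0` whenever `i` is not the rank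
of `x`. -/
def IsHomologicalCellular [GradeOrder ℕ P] (G : CoPSh R P) : Prop :=
  ∀ (x : P) (i : ℕ), i ≠ grade ℕ x → IsZero (Tor i (delta R x) G)

end Tensor

/-! ### `P`-graded differential modules -/

/-- A `P`-graded differential `R`-module: a direct sum `⨁_{x ∈ P} Λ_x` with an endomorphism `∂`
such that `∂² = 0`. -/
structure GradedDiffModule (R : Type) [CommRing R] (P : Type u) where
  /-- The homogeneous piece of degree `x`. -/
  piece : P → ModuleCat.{u} R
  /-- The differential. -/
  d : (⨁ x, piece x) →ₗ[R] ⨁ x, piece x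
  d_comp_d : d ∘ₗ d = 0

namespace GradedDiffModule

section Category

variable {R : Type} [CommRing R] {P : Type u}

/-- A morphism of `P`-graded differential modules: a family of linear maps `Λ_x → Λ'_x` commuting
with the differentials. -/
@[ext]
structure Hom (L L' : GradedDiffModule R P) where
  /-- The component of degree `x`. -/
  app : ∀ x, L.piece x →ₗ[R] L'.piece x
  comm : DirectSum.lmap app ∘ₗ L.d = L'.d ∘ₗ DirectSum.lmap app

instance category : Category (GradedDiffModule R P) where
  Hom := Hom
  id L := ⟨fun _ => LinearMap.id, by simp⟩
  comp f g := ⟨fun x => g.app x ∘ₗ f.app x, by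
    rw [DirectSum.lmap_comp, LinearMap.comp_assoc, f.comm, ← LinearMap.comp_assoc, g.comm,
      LinearMap.comp_assoc]⟩

end Category

variable {R : Type} [CommRing R] {P : Type u} [PartialOrder P]

open scoped Classical in
/-- `∂` maps `Λ_x` to `⨁_{y ⋖ x} Λ_y` for every `x`. -/
def LowersByCover (L : GradedDiffModule R P) : Prop :=
  ∀ (x : P) (a : L.piece x) (y : P),
    L.d (DirectSum.lof R P (fun x => L.piece x) x a) y ≠ 0 → y ⋖ x

variable [GradeOrder ℕ P]

/-- The degree `n` part of `Λ_{≤ x} = ⨁_{y ≤ x} Λ_y`, i.e. the submodule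
`⨁_{y ≤ x, r(y) = n} Λ_y` of `⨁_y Λ_y`. -/
def belowDeg (L : GradedDiffModule R P) (x : P) (n : ℕ) : Submodule R (⨁ x, L.piece x) where
  carrier := {a | ∀ y, a y ≠ 0 → y ≤ x ∧ grade ℕ y = n}
  zero_mem' y h := absurd rfl h
  add_mem' {a b} ha hb y h := by
    by_cases h1 : a y = 0
    · refine hb y fun h2 => h ?_
      rw [DirectSum.add_apply, h1, h2, add_zero]
    · exact ha y h1
  smul_mem' c a ha y h := ha y fun h1 => h (by rw [DirectSum.smul_apply, h1, smul_zero])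

variable {L L' L'' : GradedDiffModule R P}

lemma LowersByCover.d_mem (h : L.LowersByCover) {x : P} {n : ℕ} {a : ⨁ x, L.piece x}
    (ha : a ∈ L.belowDeg x (n + 1)) : L.d a ∈ L.belowDeg x n := by
  classical
  intro y hy
  rw [← DirectSum.sum_support_of a, map_sum, DFinsupp.finsetSum_apply] at hy
  obtain ⟨z, hz, hzy⟩ := Finset.exists_ne_zero_of_sum_ne_zero hy
  have hc : y ⋖ z := h z (a z) y (by convert hzy; rfl)
  obtain ⟨hzx, hzn⟩ := ha z (by simpa using hz)
  refine ⟨hc.le.trans hzx, ?_⟩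
  have := Nat.covBy_iff_add_one_eq.1 (hc.grade ℕ)
  omega

lemma belowDeg_mono (L : GradedDiffModule R P) {x y : P} (h : x ≤ y) (n : ℕ) :
    L.belowDeg x n ≤ L.belowDeg y n :=
  fun _ ha z hz => ⟨(ha z hz).1.trans h, (ha z hz).2⟩

lemma Hom.lmap_mem (f : L ⟶ L') {x : P} {n : ℕ} {a : ⨁ x, L.piece x}
    (ha : a ∈ L.belowDeg x n) : DirectSum.lmap (Hom.app f) a ∈ L'.belowDeg x n :=
  fun y hy => ha y fun h => hy (by rw [DirectSum.lmap_apply, h, map_zero])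

/-- The chain complex `Λ_{≤ x}`, graded by rank, with differential `∂`. -/
noncomputable def below (L : GradedDiffModule R P) (h : L.LowersByCover) (x : P) :
    ChainComplex (ModuleCat.{u} R) ℕ :=
  ChainComplex.of (fun n => ModuleCat.of R (L.belowDeg x n))
    (fun n => ModuleCat.ofHom
      (L.d.restrict (p := L.belowDeg x (n + 1)) (q := L.belowDeg x n) fun _ => h.d_mem))
    (fun n => by
      refine ModuleCat.hom_ext (LinearMap.ext fun a => Subtype.ext ?_)
      exact LinearMap.congr_fun L.d_comp_d (a : ⨁ x, L.piece x))

lemma below_d (L : GradedDiffModule R P) (h : L.LowersByCover) (x : P) (n : ℕ) :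
    (L.below h x).d (n + 1) n = ModuleCat.ofHom
      (L.d.restrict (p := L.belowDeg x (n + 1)) (q := L.belowDeg x n) fun _ => h.d_mem) :=
  ChainComplex.of_d (fun n => ModuleCat.of R (L.belowDeg x n))
    (fun n => ModuleCat.ofHom
      (L.d.restrict (p := L.belowDeg x (n + 1)) (q := L.belowDeg x n) fun _ => h.d_mem)) n

/-- The copresheaf of chain complexes `x ↦ Λ_{≤ x}`, with the inclusions `Λ_{≤ x} ↪ Λ_{≤ y}`
for `x ≤ y`. -/
noncomputable def chains (L : GradedDiffModule R P) (h : L.LowersByCover) :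
    P ⥤ ChainComplex (ModuleCat.{u} R) ℕ where
  obj x := L.below h x
  map {x y} f := ChainComplex.ofHom
    (fun n => ModuleCat.ofHom (Submodule.inclusion (L.belowDeg_mono (leOfHom f) n)))
    (fun n => by
      rw [below_d, below_d]
      rfl)
  map_id x := by ext n a; rfl
  map_comp f g := by ext n a; rfl

/-- The copresheaf `x ↦ H_0(Λ_{≤ x})`. -/
noncomputable def H₀ (L : GradedDiffModule R P) (h : L.LowersByCover) : CoPSh R P :=
  L.chains h ⋙ HomologicalComplex.homologyFunctor (ModuleCat.{u} R) (ComplexShape.down ℕ) 0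

/-- The chain maps `Λ_{≤ x} → Λ'_{≤ x}` induced by a morphism of `P`-graded differential
modules. -/
noncomputable def chainsMap (f : L ⟶ L') (h : L.LowersByCover) (h' : L'.LowersByCover) :
    L.chains h ⟶ L'.chains h' where
  app x := ChainComplex.ofHom
    (fun n => ModuleCat.ofHom
      ((DirectSum.lmap (Hom.app f)).restrict (p := L.belowDeg x n) (q := L'.belowDeg x n)
        fun _ => Hom.lmap_mem f))
    (fun n => by
      change _ ≫ (below L' h' x).d _ _ = (below L h x).d _ _ ≫ _
      rw [below_d, below_d]
      refine ModuleCat.hom_ext (LinearMap.ext fun a => Subtype.ext ?_)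
      exact (LinearMap.congr_fun (Hom.comm f)
        (show L.belowDeg x (n + 1) from a : ⨁ x, L.piece x)).symm)
  naturality x y g := by ext n a; rfl

/-- The map of copresheaves `H_0(Λ_{≤ x}) → H_0(Λ'_{≤ x})` induced by a morphism of `P`-graded
differential modules. -/
noncomputable def H₀Map (f : L ⟶ L') (h : L.LowersByCover) (h' : L'.LowersByCover) :
    L.H₀ h ⟶ L'.H₀ h' :=
  Functor.whiskerRight (chainsMap f h h')
    (HomologicalComplex.homologyFunctor (ModuleCat.{u} R) (ComplexShape.down ℕ) 0)

end GradedDiffModule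

/-- A cellular form of `(P, G)`: a `P`-graded differential `R`-module `Λ` such that
`∂ Λ_x ⊆ ⨁_{y ⋖ x} Λ_y`, each complex `Λ_{≤ x}` has trivial homology in positive degrees, and the
copresheaf `x ↦ H_0(Λ_{≤ x})` is isomorphic to `G`. -/
structure CellularForm {R : Type} [CommRing R] {P : Type u} [PartialOrder P] [GradeOrder ℕ P]
    (G : CoPSh R P) extends GradedDiffModule R P where
  lowers : toGradedDiffModule.LowersByCover
  acyclic : ∀ (x : P) (n : ℕ), 0 < n →
    IsZero ((toGradedDiffModule.below lowers x).homology n)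
  /-- The isomorphism of copresheaves `H_0(Λ_{≤ x}) ≅ G(x)`. -/
  iso : toGradedDiffModule.H₀ lowers ≅ G

end PosetCellular

/-! Write C_n for the copresheaf x ↦ ⨁_{y ≤ x, r(y) = n} Λ_y. Three facts control Tor. If the pieces
Λ_y are flat, C_n has no higher Tor, since F ⊗_P C_n is, naturally in F, a retract of ⨁ F(y) ⊗ Λ_y
(`belowTensorρ_ι`). A projective presheaf Q is a retract of a sum of representables, so Q ⊗_P - is
exact on pointwise short exact sequences (`PointwiseShortExact.tensor_exact`), which yields long
exact Tor sequences in the copresheaf variable. Finally, Tor_0(δ_x, G) vanishes exactly when G(x) is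
spanned by the images of the G(y), y < x (`isZero_tor_zero_delta_iff`); this holds for C_n at every
x of rank different from n.

A cellular form gives a resolution ... → C_1 → C_0 → G → 0. Cutting it into short exact sequences
and shifting dimensions puts Tor_i(δ_x, G) in the single degree i = r(x)
(`CellularSteps.isZero_tor`). Flatness of the pieces comes for free: no chains below x have rank
above r(x), so exactness makes ∂ (or the augmentation, in rank 0) injective on Λ_x. Torsion-freeness
thus climbs from G to all pieces, and over a Dedekind domain torsion-free modules are flat.

Conversely, put G_0 = G and let G_{n+1} be the kernel of ⨁_{y ≤ x, r(y) = n} G_n(y) → G_n(x). The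
Tor condition on G_n makes this map surjective, and the long exact sequence passes the condition to
G_{n+1} with the rank shifted by one (`CoPSh.IsCellularFrom.syzygy`). The pieces Λ_x = G_{r(x)}(x),
with differential obtained by splicing, form a cellular form (`syzygyAugmentation_isAugmentation`).

Uniqueness uses the same injectivity: Λ'_x is identified by ∂ with the cycles one rank lower in
Λ'_{≤ x}, so the component of a morphism at x is determined by, and can be built from, the
components of the preceding rank (`hom_ext`, `compare_comm`). -/

namespace PosetCellular

/-! ### Universal property and right exactness of the tensor product over a poset -/

section TensorCalculus

open scoped Classical

variable {R : Type} [CommRing R] {P : Type u} [PartialOrder P]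

/-- The class of `a ⊗ b` in `F ⊗_P G`, for `a ∈ F(p)` and `b ∈ G(p)`. -/
noncomputable def tmk (F : PSh R P) (G : CoPSh R P) (p : P) :
    F.obj (op p) →ₗ[R] G.obj p →ₗ[R] tensorObj F G :=
  (TensorProduct.mk R (F.obj (op p)) (G.obj p)).compr₂
    ((tensorRel F G).mkQ ∘ₗ DirectSum.lof R P (fun p => (F.obj (op p) ⊗[R] G.obj p : Type u)) p)

lemma tmk_map (F : PSh R P) (G : CoPSh R P) {y x : P} (h : y ≤ x) (a : F.obj (op x))
    (b : G.obj y) :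
    tmk F G y ((F.map (homOfLE h).op).hom a) b = tmk F G x a ((G.map (homOfLE h)).hom b) :=
  (Submodule.Quotient.eq _).2 (Submodule.subset_span ⟨y, x, h, a, b, rfl⟩)

lemma tensorObj_hom_ext {F : PSh R P} {G : CoPSh R P} {M : Type*} [AddCommGroup M] [Module R M]
    {f g : tensorObj F G →ₗ[R] M} (h : ∀ p a b, f (tmk F G p a b) = g (tmk F G p a b)) :
    f = g := by
  refine Submodule.linearMap_qext _ (DirectSum.linearMap_ext R fun p => ?_)
  exact TensorProduct.ext' fun a b => h p a b

/-- The linear map out of `F ⊗_P G` given by a compatible family of bilinear maps. -/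
noncomputable def tensorLift {F : PSh R P} {G : CoPSh R P} {M : Type*} [AddCommGroup M]
    [Module R M] (φ : ∀ p, F.obj (op p) →ₗ[R] G.obj p →ₗ[R] M)
    (hφ : ∀ (y x : P) (h : y ≤ x) (a : F.obj (op x)) (b : G.obj y),
      φ y ((F.map (homOfLE h).op).hom a) b = φ x a ((G.map (homOfLE h)).hom b)) :
    tensorObj F G →ₗ[R] M :=
  (tensorRel F G).liftQ (DirectSum.toModule R P M fun p => TensorProduct.lift (φ p)) <| by
    refine Submodule.span_le.2 ?_
    rintro _ ⟨y, x, h, a, b, rfl⟩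
    simp [hφ y x h a b]

@[simp]
lemma tensorLift_tmk {F : PSh R P} {G : CoPSh R P} {M : Type*} [AddCommGroup M]
    [Module R M] (φ : ∀ p, F.obj (op p) →ₗ[R] G.obj p →ₗ[R] M) (hφ) (p a b) :
    tensorLift φ hφ (tmk F G p a b) = φ p a b := by
  change (DirectSum.toModule R P M fun p => TensorProduct.lift (φ p)) (DirectSum.lof R P
    (fun p => (F.obj (op p) ⊗[R] G.obj p : Type u)) p (a ⊗ₜ[R] b)) = _
  rw [DirectSum.toModule_lof, TensorProduct.lift.tmul]

@[simp]
lemma tensorMap_tmk {F F' : PSh R P} (f : F ⟶ F') (G : CoPSh R P) (p a b) :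
    tensorMap f G (tmk F G p a b) = tmk F' G p ((f.app (op p)).hom a) b := by
  change Submodule.Quotient.mk (tensorSumMap f G (DirectSum.lof R P
    (fun p => (F.obj (op p) ⊗[R] G.obj p : Type u)) p (a ⊗ₜ[R] b))) = _
  rw [tensorSumMap, DirectSum.lmap_lof, LinearMap.rTensor_tmul]
  rfl

/-- The map `F ⊗_P G → F ⊗_P G'` induced by a morphism `G ⟶ G'`. -/
noncomputable def tensorMapRight (F : PSh R P) {G G' : CoPSh R P} (g : G ⟶ G') :
    tensorObj F G →ₗ[R] tensorObj F G' :=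
  tensorLift (fun p => (tmk F G' p).compl₂ (g.app p).hom) fun y x h a b => by
    have e : (g.app x).hom ((G.map (homOfLE h)).hom b) =
        (G'.map (homOfLE h)).hom ((g.app y).hom b) :=
      congrArg (fun k => k.hom b) (g.naturality (homOfLE h))
    simp only [LinearMap.compl₂_apply, e, tmk_map]

@[simp]
lemma tensorMapRight_tmk (F : PSh R P) {G G' : CoPSh R P} (g : G ⟶ G') (p a b) :
    tensorMapRight F g (tmk F G p a b) = tmk F G' p a ((g.app p).hom b) := by
  simp [tensorMapRight]

/-- The natural transformation `- ⊗_P G ⟶ - ⊗_P G'` induced by a morphism `G ⟶ G'`. -/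
noncomputable def tensorTrans {G G' : CoPSh R P} (g : G ⟶ G') : tensor G ⟶ tensor G' where
  app F := ModuleCat.ofHom (tensorMapRight F g)
  naturality F F' f := by
    refine ModuleCat.hom_ext (tensorObj_hom_ext fun p a b => ?_)
    change tensorMapRight F' g (tensorMap f G (tmk F G p a b)) =
      tensorMap f G' (tensorMapRight F g (tmk F G p a b))
    simp

/-- The functor `M ↦ Hom(G(-), M)` from modules to presheaves. -/
noncomputable def cohom (G : CoPSh R P) : ModuleCat.{u} R ⥤ PSh R P where
  obj M :=
    { obj := fun x => ModuleCat.of R (G.obj x.unop →ₗ[R] M)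
      map := fun f => ModuleCat.ofHom (LinearMap.lcomp R M (G.map f.unop).hom)
      map_id := fun x => by ext; simp
      map_comp := fun f g => by ext; simp }
  map φ :=
    { app := fun x => ModuleCat.ofHom (LinearMap.compRight R φ.hom)
      naturality := fun x y f => rfl }

/-- The morphism `F ⟶ Hom(G(-), M)` corresponding to a linear map `F ⊗_P G → M`. -/
noncomputable def tensorCurry {F : PSh R P} {G : CoPSh R P} {M : ModuleCat.{u} R}
    (f : tensorObj F G →ₗ[R] M) : F ⟶ (cohom G).obj M where
  app p := ModuleCat.ofHom ((tmk F G p.unop).compr₂ f)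
  naturality x y h := by
    refine ModuleCat.hom_ext (LinearMap.ext fun a => LinearMap.ext fun b => ?_)
    exact congrArg f (tmk_map F G (leOfHom h.unop) a b)

/-- The linear map `F ⊗_P G → M` corresponding to a morphism `F ⟶ Hom(G(-), M)`. -/
noncomputable def tensorUncurry {F : PSh R P} {G : CoPSh R P} {M : ModuleCat.{u} R}
    (f : F ⟶ (cohom G).obj M) : tensorObj F G →ₗ[R] M :=
  tensorLift (fun p => (f.app (op p)).hom) fun _ _ h a b =>
    LinearMap.congr_fun (congrArg (fun k => k.hom a) (f.naturality (homOfLE h).op)) b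

lemma tensorUncurry_tmk {F : PSh R P} {G : CoPSh R P} {M : ModuleCat.{u} R}
    (f : F ⟶ (cohom G).obj M) (p a b) :
    tensorUncurry f (tmk F G p a b) = (show G.obj p →ₗ[R] M from (f.app (op p)).hom a) b :=
  tensorLift_tmk _ _ p a b

/-- The bijection between linear maps `F ⊗_P G → M` and morphisms `F ⟶ Hom(G(-), M)`. -/
noncomputable def tensorHomEquiv (F : PSh R P) (G : CoPSh R P) (M : ModuleCat.{u} R) :
    ((tensor G).obj F ⟶ M) ≃ (F ⟶ (cohom G).obj M) where
  toFun f := tensorCurry (G := G) (F := F) f.hom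
  invFun f := ModuleCat.ofHom (tensorUncurry f)
  left_inv f := ModuleCat.hom_ext (tensorObj_hom_ext fun p a b => tensorUncurry_tmk _ p a b)
  right_inv f := by
    refine NatTrans.ext (funext fun p => ModuleCat.hom_ext (LinearMap.ext fun a => ?_))
    exact LinearMap.ext fun b => tensorUncurry_tmk f p.unop a b

/-- The functor `- ⊗_P G` is left adjoint to `M ↦ Hom(G(-), M)`. -/
noncomputable def tensorAdjunction (G : CoPSh R P) : tensor G ⊣ cohom G :=
  Adjunction.mkOfHomEquiv
    { homEquiv := fun F M => tensorHomEquiv F G M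
      homEquiv_naturality_left_symm := fun f g =>
        ModuleCat.hom_ext (tensorObj_hom_ext fun p a b => by
          refine (tensorUncurry_tmk _ p a b).trans ?_
          refine Eq.trans ?_ (congrArg (tensorUncurry g) (tensorMap_tmk f G p a b)).symm
          exact (tensorUncurry_tmk g p _ b).symm)
      homEquiv_naturality_right := fun f g => rfl }

/-- Left adjoints preserve colimits. This right exactness is what identifies the zeroth derived
functor with the tensor product itself. -/
instance tensor_preservesFiniteColimits (G : CoPSh R P) : PreservesFiniteColimits (tensor G) :=
  have : PreservesColimitsOfSize.{0, 0} (tensor G) :=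
    (tensorAdjunction G).leftAdjoint_preservesColimits
  inferInstance

/-- `Tor_0` is the tensor product. -/
noncomputable def torZeroIso (F : PSh R P) (G : CoPSh R P) :
    Tor 0 F G ≅ ModuleCat.of R (tensorObj F G) :=
  (tensor G).leftDerivedZeroIsoSelf.app F

end TensorCalculus
end PosetCellular

namespace PosetCellular

/-! ### Tensoring with a projective presheaf is exact in the copresheaf -/

section ProjectiveFlat

open scoped Classical

variable {R : Type} [CommRing R] {P : Type u} [PartialOrder P]

/-- The restriction map `F(x) → F(z)` if `z ≤ x`, and zero otherwise. -/
noncomputable def PSh.res (F : PSh R P) (x z : P) : F.obj (op x) →ₗ[R] F.obj (op z) :=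
  if h : z ≤ x then (F.map (homOfLE h).op).hom else 0

/-- The extension map `G(z) → G(x)` if `z ≤ x`, and zero otherwise. -/
noncomputable def CoPSh.ext (G : CoPSh R P) (z x : P) : G.obj z →ₗ[R] G.obj x :=
  if h : z ≤ x then (G.map (homOfLE h)).hom else 0

lemma PSh.res_of_le (F : PSh R P) {x z : P} (h : z ≤ x) :
    F.res x z = (F.map (homOfLE h).op).hom := dif_pos h

lemma CoPSh.ext_of_le (G : CoPSh R P) {z x : P} (h : z ≤ x) :
    G.ext z x = (G.map (homOfLE h)).hom := dif_pos h

lemma PSh.res_res (F : PSh R P) {x y z : P} (h : y ≤ x) (h' : z ≤ y) (a : F.obj (op x)) :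
    F.res y z (F.res x y a) = F.res x z a := by
  rw [F.res_of_le h, F.res_of_le h', F.res_of_le (h'.trans h), ← homOfLE_comp h' h, op_comp,
    F.map_comp]
  rfl

lemma CoPSh.ext_ext (G : CoPSh R P) {x y z : P} (h : x ≤ y) (h' : y ≤ z) (a : G.obj x) :
    G.ext y z (G.ext x y a) = G.ext x z a := by
  rw [G.ext_of_le h, G.ext_of_le h', G.ext_of_le (h.trans h'), ← homOfLE_comp h h', G.map_comp]
  rfl

lemma PSh.res_self (F : PSh R P) (x : P) (a : F.obj (op x)) : F.res x x a = a := by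
  rw [F.res_of_le le_rfl, show homOfLE (le_refl x) = 𝟙 x from rfl, op_id, F.map_id]
  rfl

lemma CoPSh.ext_self (G : CoPSh R P) (x : P) (a : G.obj x) : G.ext x x a = a := by
  rw [G.ext_of_le le_rfl, show homOfLE (le_refl x) = 𝟙 x from rfl, G.map_id]
  rfl

lemma PSh.res_app {F F' : PSh R P} (f : F ⟶ F') (x z : P) (a : F.obj (op x)) :
    (f.app (op z)).hom (F.res x z a) = F'.res x z ((f.app (op x)).hom a) := by
  by_cases h : z ≤ x
  · rw [F.res_of_le h, F'.res_of_le h]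
    exact congrArg (fun k => k.hom a) (f.naturality (homOfLE h).op)
  · simp [PSh.res, h]

lemma CoPSh.ext_app {G G' : CoPSh R P} (g : G ⟶ G') (z x : P) (a : G.obj z) :
    (g.app x).hom (G.ext z x a) = G'.ext z x ((g.app z).hom a) := by
  by_cases h : z ≤ x
  · rw [G.ext_of_le h, G'.ext_of_le h]
    exact congrArg (fun k => k.hom a) (g.naturality (homOfLE h))
  · simp [CoPSh.ext, h]

lemma tmk_res (F : PSh R P) (G : CoPSh R P) {y x : P} (h : y ≤ x) (a : F.obj (op x))
    (b : G.obj y) : tmk F G y (F.res x y a) b = tmk F G x a (G.ext y x b) := by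
  rw [F.res_of_le h, G.ext_of_le h, tmk_map]

/-- The presheaf freely generated by all the elements of the values of `Q`. -/
noncomputable def freeCover (Q : PSh R P) : PSh R P where
  obj z := ModuleCat.of R
    (Finsupp.supported R R {σ : Σ x : P, Q.obj (op x) | z.unop ≤ σ.1})
  map f := ModuleCat.ofHom (Submodule.inclusion
    (Finsupp.supported_mono fun _ h => (leOfHom f.unop).trans h))
  map_id _ := rfl
  map_comp _ _ := rfl

/-- The evaluation map onto `Q` from the presheaf freely generated by its elements. -/
noncomputable def freeCoverπ (Q : PSh R P) : freeCover Q ⟶ Q where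
  app z := ModuleCat.ofHom ((Finsupp.linearCombination R
    fun σ : Σ x : P, Q.obj (op x) => Q.res σ.1 z.unop σ.2) ∘ₗ Submodule.subtype _)
  naturality z z' f := by
    refine ModuleCat.hom_ext (LinearMap.ext fun s => ?_)
    obtain ⟨s, hs⟩ := s
    change Finsupp.linearCombination R _ s = (Q.map f).hom (Finsupp.linearCombination R _ s)
    rw [Finsupp.linearCombination_apply, Finsupp.linearCombination_apply, Finsupp.sum,
      Finsupp.sum, map_sum]
    refine Finset.sum_congr rfl fun σ hσ => ?_
    have h : z.unop ≤ σ.1 := hs hσ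
    rw [map_smul]
    congr 1
    rw [← PSh.res_res Q h (leOfHom f.unop), PSh.res_of_le Q (leOfHom f.unop)]
    rfl

instance (Q : PSh R P) : Epi (freeCoverπ Q) := by
  have (z : Pᵒᵖ) : Epi ((freeCoverπ Q).app z) := by
    rw [ModuleCat.epi_iff_surjective]
    intro a
    refine ⟨⟨Finsupp.single ⟨z.unop, a⟩ 1, ?_⟩, ?_⟩
    · exact (Finsupp.mem_supported _ _).2
        ((Finset.coe_subset.2 Finsupp.support_single_subset).trans (by simp))
    · change Finsupp.linearCombination R _ (Finsupp.single (⟨z.unop, a⟩ : Σ x : P, Q.obj (op x))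
        (1 : R)) = a
      rw [Finsupp.linearCombination_single, one_smul]
      exact Q.res_self _ a
  exact NatTrans.epi_of_epi_app _

/-- A section of the cover of a projective presheaf by a free presheaf. -/
noncomputable def freeCoverSection (Q : PSh R P) [Projective Q] : Q ⟶ freeCover Q :=
  Projective.factorThru (𝟙 Q) (freeCoverπ Q)

/-- The coefficients of the section of the cover of a projective presheaf by a free presheaf. -/
noncomputable def freeCoeff (Q : PSh R P) [Projective Q] (z : P) :
    Q.obj (op z) →ₗ[R] (Σ x : P, Q.obj (op x)) →₀ R :=
  Submodule.subtype _ ∘ₗ ((freeCoverSection Q).app (op z)).hom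

lemma le_of_mem_support_freeCoeff (Q : PSh R P) [Projective Q] {z : P} {q : Q.obj (op z)}
    {σ : Σ x : P, Q.obj (op x)} (h : σ ∈ (freeCoeff Q z q).support) : z ≤ σ.1 :=
  (((freeCoverSection Q).app (op z)).hom q).2 h

/-- The section equation evaluated at `q`: a dual basis formula for projective presheaves. -/
lemma sum_freeCoeff (Q : PSh R P) [Projective Q] (z : P) (q : Q.obj (op z)) :
    ∑ σ ∈ (freeCoeff Q z q).support, freeCoeff Q z q σ • Q.res σ.1 z σ.2 = q :=
  congrArg (fun f => (f.app (op z)).hom q) (Projective.factorThru_comp (𝟙 Q) (freeCoverπ Q))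

/-- All values of the free cover lie in one fixed module and its restrictions are inclusions, so
naturality of the section says that coefficients do not change under restriction. -/
lemma freeCoeff_res (Q : PSh R P) [Projective Q] {z z' : P} (h : z' ≤ z) (q : Q.obj (op z)) :
    freeCoeff Q z' ((Q.map (homOfLE h).op).hom q) = freeCoeff Q z q :=
  congrArg (fun f : Q.obj (op z) ⟶ (freeCover Q).obj (op z') =>
    (show Finsupp.supported R R _ from f.hom q).1) ((freeCoverSection Q).naturality (homOfLE h).op)

/-- The embedding of `Q ⊗_P G`, for `Q` projective, in a direct sum of values of `G`. -/
noncomputable def projTensorι (Q : PSh R P) [Projective Q] (G : CoPSh R P) :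
    tensorObj Q G →ₗ[R] ⨁ σ : (Σ x : P, Q.obj (op x)), G.obj σ.1 :=
  tensorLift (fun z => (Finsupp.linearCombination R fun σ =>
      DirectSum.lof R _ (fun σ : (Σ x : P, Q.obj (op x)) => G.obj σ.1) σ ∘ₗ G.ext z σ.1) ∘ₗ
        freeCoeff Q z) fun y x h a b => by
    simp only [LinearMap.comp_apply, freeCoeff_res, Finsupp.linearCombination_apply, Finsupp.sum,
      LinearMap.sum_apply, LinearMap.smul_apply]
    refine Finset.sum_congr rfl fun σ hσ => ?_
    rw [← G.ext_ext h (le_of_mem_support_freeCoeff Q hσ), G.ext_of_le h]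

lemma projTensorι_tmk (Q : PSh R P) [Projective Q] (G : CoPSh R P) (z q b) :
    projTensorι Q G (tmk Q G z q b) = ∑ σ ∈ (freeCoeff Q z q).support, freeCoeff Q z q σ •
      DirectSum.lof R _ (fun σ : (Σ x : P, Q.obj (op x)) => G.obj σ.1) σ (G.ext z σ.1 b) := by
  rw [projTensorι, tensorLift_tmk]
  simp [Finsupp.linearCombination_apply, Finsupp.sum, LinearMap.sum_apply]

/-- The retraction of a direct sum of values of `G` onto `Q ⊗_P G`. -/
noncomputable def projTensorρ (Q : PSh R P) (G : CoPSh R P) :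
    (⨁ σ : (Σ x : P, Q.obj (op x)), G.obj σ.1) →ₗ[R] tensorObj Q G :=
  DirectSum.toModule R _ _ fun σ => tmk Q G σ.1 σ.2

/-- The embedding pushes `b` up to the point of each generator. Moving this extension back across
the tensor sign turns it into restriction of the generator, and the dual basis formula reassembles
`q`. -/
lemma projTensorρ_ι (Q : PSh R P) [Projective Q] (G : CoPSh R P) (t : tensorObj Q G) :
    projTensorρ Q G (projTensorι Q G t) = t := by
  suffices projTensorρ Q G ∘ₗ projTensorι Q G = LinearMap.id from LinearMap.congr_fun this t
  refine tensorObj_hom_ext fun z q b => ?_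
  rw [LinearMap.comp_apply, projTensorι_tmk, map_sum, LinearMap.id_apply]
  conv_rhs => rw [← sum_freeCoeff Q z q, map_sum, LinearMap.sum_apply]
  refine Finset.sum_congr rfl fun σ hσ => ?_
  rw [map_smul, map_smul, LinearMap.smul_apply, projTensorρ, DirectSum.toModule_lof,
    tmk_res Q G (le_of_mem_support_freeCoeff Q hσ)]

/-- Both halves of the retraction are natural in `G`; this is what lets exactness pass from direct
sums of values of `G` to `Q ⊗_P G`. -/
lemma projTensorι_map (Q : PSh R P) [Projective Q] {G G' : CoPSh R P} (g : G ⟶ G')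
    (t : tensorObj Q G) : projTensorι Q G' (tensorMapRight Q g t) =
      DirectSum.lmap (fun σ => (g.app σ.1).hom) (projTensorι Q G t) := by
  suffices projTensorι Q G' ∘ₗ tensorMapRight Q g =
      DirectSum.lmap (fun σ => (g.app σ.1).hom) ∘ₗ projTensorι Q G from LinearMap.congr_fun this t
  refine tensorObj_hom_ext fun z q b => ?_
  simp only [LinearMap.comp_apply, tensorMapRight_tmk, projTensorι_tmk, map_sum, map_smul,
    DirectSum.lmap_lof, CoPSh.ext_app]

lemma projTensorρ_map (Q : PSh R P) {G G' : CoPSh R P} (g : G ⟶ G')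
    (t : ⨁ σ : (Σ x : P, Q.obj (op x)), G.obj σ.1) : projTensorρ Q G'
      (DirectSum.lmap (fun σ => (g.app σ.1).hom) t) = tensorMapRight Q g (projTensorρ Q G t) := by
  suffices projTensorρ Q G' ∘ₗ DirectSum.lmap (fun σ => (g.app σ.1).hom) =
      tensorMapRight Q g ∘ₗ projTensorρ Q G from LinearMap.congr_fun this t
  refine DirectSum.linearMap_ext R fun σ => LinearMap.ext fun b => ?_
  simp [projTensorρ, DirectSum.toModule_lof, DirectSum.lmap_lof]

lemma lmap_exact {ι : Type*} {A B C : ι → Type*} [∀ i, AddCommGroup (A i)]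
    [∀ i, AddCommGroup (B i)] [∀ i, AddCommGroup (C i)] [∀ i, Module R (A i)]
    [∀ i, Module R (B i)] [∀ i, Module R (C i)] {f : ∀ i, A i →ₗ[R] B i} {g : ∀ i, B i →ₗ[R] C i}
    (h : ∀ i, Function.Exact (f i) (g i)) :
    Function.Exact (DirectSum.lmap f) (DirectSum.lmap g) := by
  intro b
  constructor
  · intro hb
    have hb' (i) : ∃ a, f i a = b i := (h i (b i)).1 (DFunLike.congr_fun hb i)
    choose a ha using hb'
    refine ⟨∑ i ∈ DFinsupp.support b, DirectSum.lof R ι A i (a i), ?_⟩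
    rw [map_sum]
    conv_rhs => rw [← DirectSum.sum_support_of b]
    refine Finset.sum_congr rfl fun i _ => ?_
    rw [DirectSum.lmap_lof, ha]
    rfl
  · rintro ⟨a, rfl⟩
    exact DFinsupp.ext fun i => (h i (f i (a i))).2 ⟨_, rfl⟩

/-- A sequence `0 → G' → G → G'' → 0` of copresheaves which is exact at every point. -/
structure PointwiseShortExact {G' G G'' : CoPSh R P} (f : G' ⟶ G) (g : G ⟶ G'') : Prop where
  injective : ∀ x, Function.Injective (f.app x).hom
  exact : ∀ x, Function.Exact (f.app x).hom (g.app x).hom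
  surjective : ∀ x, Function.Surjective (g.app x).hom

variable {G' G G'' : CoPSh R P} {f : G' ⟶ G} {g : G ⟶ G''}

lemma PointwiseShortExact.tensor_injective (h : PointwiseShortExact f g)
    (Q : PSh R P) [Projective Q] :
    Function.Injective (tensorMapRight Q f) := by
  intro s t hst
  have h1 := congrArg (projTensorι Q G) hst
  rw [projTensorι_map, projTensorι_map] at h1
  have h2 := (DirectSum.lmap_injective _).2 (fun σ => h.injective σ.1) h1
  rw [← projTensorρ_ι Q G' s, h2, projTensorρ_ι]

lemma PointwiseShortExact.tensor_surjective (h : PointwiseShortExact f g)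
    (Q : PSh R P) [Projective Q] :
    Function.Surjective (tensorMapRight Q g) := by
  intro t
  obtain ⟨s, hs⟩ := (DirectSum.lmap_surjective _).2
    (fun σ : (Σ x : P, Q.obj (op x)) => h.surjective σ.1) (projTensorι Q G'' t)
  exact ⟨projTensorρ Q G s, by rw [← projTensorρ_map, hs, projTensorρ_ι]⟩

lemma PointwiseShortExact.tensor_exact (h : PointwiseShortExact f g)
    (Q : PSh R P) [Projective Q] :
    Function.Exact (tensorMapRight Q f) (tensorMapRight Q g) := by
  have he := lmap_exact (R := R) (fun σ : (Σ x : P, Q.obj (op x)) => h.exact σ.1)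
  intro t
  constructor
  · intro ht
    obtain ⟨s, hs⟩ := (he (projTensorι Q G t)).1 (by rw [← projTensorι_map, ht, map_zero])
    exact ⟨projTensorρ Q G' s, by rw [← projTensorρ_map, hs, projTensorρ_ι]⟩
  · rintro ⟨s, rfl⟩
    rw [← projTensorρ_ι Q G'' (tensorMapRight Q g _), projTensorι_map, projTensorι_map,
      he.apply_apply_eq_zero, map_zero]

end ProjectiveFlat
end PosetCellular

namespace PosetCellular

/-! ### Long exact Tor sequences in the copresheaf variable -/

section LongExact

variable {R : Type} [CommRing R] {P : Type u} [PartialOrder P]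

/-- The complex `Q ⊗_P G`, for a projective resolution `Q` of `F`. -/
noncomputable abbrev tensorComplex (G : CoPSh R P) {F : PSh R P} (Q : ProjectiveResolution F) :
    ChainComplex (ModuleCat.{u} R) ℕ :=
  ((tensor G).mapHomologicalComplex _).obj Q.complex

/-- The map of complexes `Q ⊗_P G ⟶ Q ⊗_P G'` induced by a morphism `G ⟶ G'`. -/
noncomputable abbrev tensorComplexMap {G G' : CoPSh R P} (g : G ⟶ G') {F : PSh R P}
    (Q : ProjectiveResolution F) : tensorComplex G Q ⟶ tensorComplex G' Q :=
  (NatTrans.mapHomologicalComplex (tensorTrans g) _).app Q.complex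

lemma isZero_tor_iff (G : CoPSh R P) {F : PSh R P} (Q : ProjectiveResolution F) (n : ℕ) :
    IsZero (Tor n F G) ↔ IsZero ((tensorComplex G Q).homology n) :=
  (Q.isoLeftDerivedObj (tensor G) n).isZero_iff

variable {G' G G'' : CoPSh R P} {f : G' ⟶ G} {g : G ⟶ G''}

lemma PointwiseShortExact.tensorComplexMap_comp (h : PointwiseShortExact f g) {F : PSh R P}
    (Q : ProjectiveResolution F) : tensorComplexMap f Q ≫ tensorComplexMap g Q = 0 := by
  refine HomologicalComplex.hom_ext _ _ fun n => ModuleCat.hom_ext (LinearMap.ext fun t => ?_)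
  exact (h.tensor_exact (Q.complex.X n)).apply_apply_eq_zero t

lemma PointwiseShortExact.tensorComplex (h : PointwiseShortExact f g) {F : PSh R P}
    (Q : ProjectiveResolution F) : (ShortComplex.mk (tensorComplexMap f Q) (tensorComplexMap g Q)
      (h.tensorComplexMap_comp Q)).ShortExact := by
  refine HomologicalComplex.shortExact_of_degreewise_shortExact _ fun n => ?_
  exact ModuleCat.shortComplex_shortExact _ (h.tensor_exact (Q.complex.X n))
    (h.tensor_injective (Q.complex.X n)) (h.tensor_surjective (Q.complex.X n))

/-- In the long exact sequence Tor_{n+1}(F, G'') sits between Tor_{n+1}(F, G) and Tor_n(F, G'). -/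
lemma PointwiseShortExact.isZero_tor_right (h : PointwiseShortExact f g) {F : PSh R P} {n : ℕ}
    (h₁ : IsZero (Tor n F G')) (h₂ : IsZero (Tor (n + 1) F G)) : IsZero (Tor (n + 1) F G'') := by
  let Q := projectiveResolution F
  rw [isZero_tor_iff _ Q] at *
  exact ((h.tensorComplex Q).homology_exact₃ (n + 1) n rfl).isZero_of_both_zeros
    (h₂.eq_of_src _ _) (h₁.eq_of_tgt _ _)

/-- In the long exact sequence Tor_n(F, G') sits between Tor_{n+1}(F, G'') and Tor_n(F, G). -/
lemma PointwiseShortExact.isZero_tor_left (h : PointwiseShortExact f g) {F : PSh R P} {n : ℕ}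
    (h₁ : IsZero (Tor (n + 1) F G'')) (h₂ : IsZero (Tor n F G)) : IsZero (Tor n F G') := by
  let Q := projectiveResolution F
  rw [isZero_tor_iff _ Q] at *
  exact ((h.tensorComplex Q).homology_exact₁ (n + 1) n rfl).isZero_of_both_zeros
    (h₁.eq_of_src _ _) (h₂.eq_of_tgt _ _)

/-- Right exactness together with preservation of monomorphisms makes `tensor G` exact, so a
projective resolution stays exact in positive degrees. -/
lemma isZero_tor_succ_of_injective (G : CoPSh R P)
    (hG : ∀ {F F' : PSh R P} (f : F ⟶ F'), (∀ x, Function.Injective (f.app x).hom) →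
      Function.Injective (tensorMap f G)) (F : PSh R P) (n : ℕ) : IsZero (Tor (n + 1) F G) := by
  have : (tensor G).PreservesMonomorphisms :=
    ⟨fun f _ => (ModuleCat.mono_iff_injective _).2 (hG f fun x =>
      (ModuleCat.mono_iff_injective _).1 inferInstance)⟩
  have : (tensor G).PreservesHomology := (tensor G).preservesHomology_of_preservesMonos_and_cokernels
  let Q := projectiveResolution F
  rw [isZero_tor_iff _ Q, ← HomologicalComplex.exactAt_iff_isZero_homology]
  exact ShortComplex.Exact.map (Q.complex_exactAt_succ n) (tensor G)

end LongExact

/-! ### Vanishing of higher Tor for the copresheaves of chains -/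

namespace GradedDiffModule

open scoped Classical

variable {R : Type} [CommRing R] {P : Type u} [PartialOrder P] [GradeOrder ℕ P]

/-- The copresheaf `x ↦ ⨁_{y ≤ x, r(y) = n} Λ_y`. -/
noncomputable def belowCopresheaf (L : GradedDiffModule R P) (n : ℕ) : CoPSh R P where
  obj x := ModuleCat.of R (L.belowDeg x n)
  map f := ModuleCat.ofHom (Submodule.inclusion (L.belowDeg_mono (leOfHom f) n))

lemma lof_mem_belowDeg (L : GradedDiffModule R P) {x y : P} {n : ℕ} (h : y ≤ x)
    (hn : grade ℕ y = n) (c : L.piece y) :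
    DirectSum.lof R P (fun y => L.piece y) y c ∈ L.belowDeg x n := by
  intro z hz
  by_cases hzy : z = y
  · subst hzy
    exact ⟨h, hn⟩
  · refine absurd ?_ hz
    rw [DirectSum.lof_eq_of, DirectSum.of_eq_of_ne _ _ _ hzy]

/-- The inclusion of `Λ_y` in `⨁_{y ≤ x, r(y) = n} Λ_y`. -/
noncomputable def belowOf (L : GradedDiffModule R P) {x y : P} {n : ℕ} (h : y ≤ x)
    (hn : grade ℕ y = n) : L.piece y →ₗ[R] L.belowDeg x n :=
  (DirectSum.lof R P (fun y => L.piece y) y).codRestrict _ (L.lof_mem_belowDeg h hn)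

lemma coe_belowOf (L : GradedDiffModule R P) {x y : P} {n : ℕ} (h : y ≤ x)
    (hn : grade ℕ y = n) (c : L.piece y) :
    (L.belowOf h hn c : ⨁ y, L.piece y) = DirectSum.lof R P (fun y => L.piece y) y c := rfl

lemma belowDeg_induction {L : GradedDiffModule R P} {x : P} {n : ℕ}
    {p : L.belowDeg x n → Prop} (zero : p 0) (add : ∀ a b, p a → p b → p (a + b))
    (of : ∀ (y : P) (h : y ≤ x) (hn : grade ℕ y = n) (c : L.piece y), p (L.belowOf h hn c))
    (a : L.belowDeg x n) : p a := by
  -- The default 0 is never met on the support of `a`, where membership in `belowDeg` supplies both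
  -- conditions.
  let e (y : P) : L.belowDeg x n :=
    if h : y ≤ x ∧ grade ℕ y = n then L.belowOf h.1 h.2 (a.1 y) else 0
  have ha : a = ∑ y ∈ DFinsupp.support a.1, e y := by
    refine Subtype.ext ?_
    rw [AddSubmonoidClass.coe_finsetSum]
    conv_lhs => rw [← DirectSum.sum_support_of a.1]
    refine Finset.sum_congr rfl fun y hy => ?_
    have h := a.2 y (by simpa using hy)
    simp only [e, dif_pos h, coe_belowOf]
    rfl
  rw [ha]
  refine Finset.sum_induction e p add zero fun y _ => ?_
  by_cases h : y ≤ x ∧ grade ℕ y = n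
  · simp only [e, dif_pos h, of]
  · simp only [e, dif_neg h, zero]

lemma belowDeg_hom_ext {L : GradedDiffModule R P} {x : P} {n : ℕ} {M : Type*} [AddCommGroup M]
    [Module R M] {f g : L.belowDeg x n →ₗ[R] M} (h : ∀ (y : P) (h : y ≤ x) (hn : grade ℕ y = n)
      (c : L.piece y), f (L.belowOf h hn c) = g (L.belowOf h hn c)) : f = g :=
  LinearMap.ext fun a => belowDeg_induction (p := fun a => f a = g a) (by simp)
    (fun a b ha hb => by rw [map_add, map_add, ha, hb]) h a

lemma belowCopresheaf_ext_belowOf (L : GradedDiffModule R P) {x y z : P} {n : ℕ} (h : z ≤ y)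
    (hn : grade ℕ z = n) (hx : y ≤ x) (c : L.piece z) :
    (L.belowCopresheaf n).ext y x (L.belowOf h hn c) = L.belowOf (h.trans hx) hn c := by
  rw [CoPSh.ext_of_le _ hx]
  rfl

/-- The bilinear map `F(z) × ⨁_{y ≤ z, r(y) = n} Λ_y → ⨁_y F(y) ⊗ Λ_y` given by restriction. -/
noncomputable def belowPairing (L : GradedDiffModule R P) (n : ℕ) (F : PSh R P) (z : P) :
    F.obj (op z) →ₗ[R] L.belowDeg z n →ₗ[R]
      ⨁ y : P, (F.obj (op y) ⊗[R] L.piece y : Type u) :=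
  (DirectSum.toModule R P _ (fun y =>
    ((TensorProduct.mk R (F.obj (op y)) (L.piece y)).compr₂ (DirectSum.lof R P
      (fun y => (F.obj (op y) ⊗[R] L.piece y : Type u)) y) ∘ₗ F.res z y).flip) ∘ₗ
        (L.belowDeg z n).subtype).flip

lemma belowPairing_belowOf (L : GradedDiffModule R P) {n : ℕ} (F : PSh R P) {y z : P}
    (h : y ≤ z) (hn : grade ℕ y = n) (a : F.obj (op z)) (c : L.piece y) :
    L.belowPairing n F z a (L.belowOf h hn c) =
      DirectSum.lof R P (fun y => (F.obj (op y) ⊗[R] L.piece y : Type u)) y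
        (F.res z y a ⊗ₜ[R] c) := by
  rw [belowPairing, LinearMap.flip_apply, LinearMap.comp_apply, Submodule.subtype_apply,
    coe_belowOf, DirectSum.toModule_lof]
  rfl

/-- The embedding of `F ⊗_P (⨁_{y ≤ •, r(y) = n} Λ_y)` in `⨁_y F(y) ⊗ Λ_y`. -/
noncomputable def belowTensorι (L : GradedDiffModule R P) (n : ℕ) (F : PSh R P) :
    tensorObj F (L.belowCopresheaf n) →ₗ[R] ⨁ y : P, (F.obj (op y) ⊗[R] L.piece y : Type u) :=
  tensorLift (G := L.belowCopresheaf n) (L.belowPairing n F) fun y x h a b => by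
    revert b
    refine LinearMap.congr_fun (g := L.belowPairing n F x a ∘ₗ
      ((L.belowCopresheaf n).map (homOfLE h)).hom) (belowDeg_hom_ext fun z hz hn c => ?_)
    refine (L.belowPairing_belowOf F hz hn _ c).trans
      (Eq.trans ?_ (L.belowPairing_belowOf F (hz.trans h) hn a c).symm)
    rw [← F.res_of_le, F.res_res h hz]

lemma belowTensorι_tmk (L : GradedDiffModule R P) {n : ℕ} (F : PSh R P) {y z : P} (h : y ≤ z)
    (hn : grade ℕ y = n) (a : F.obj (op z)) (c : L.piece y) :
    L.belowTensorι n F (tmk F (L.belowCopresheaf n) z a (L.belowOf h hn c)) =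
      DirectSum.lof R P (fun y => (F.obj (op y) ⊗[R] L.piece y : Type u)) y
        (F.res z y a ⊗ₜ[R] c) :=
  (tensorLift_tmk (G := L.belowCopresheaf n) _ _ z a (L.belowOf h hn c)).trans
    (L.belowPairing_belowOf F h hn a c)

lemma belowTensor_hom_ext {L : GradedDiffModule R P} {n : ℕ} {F : PSh R P} {M : Type*}
    [AddCommGroup M] [Module R M] {f g : tensorObj F (L.belowCopresheaf n) →ₗ[R] M}
    (h : ∀ (y z : P) (h : y ≤ z) (hn : grade ℕ y = n) (a : F.obj (op z)) (c : L.piece y),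
      f (tmk F (L.belowCopresheaf n) z a (L.belowOf h hn c)) =
        g (tmk F (L.belowCopresheaf n) z a (L.belowOf h hn c))) : f = g :=
  tensorObj_hom_ext fun z a => LinearMap.congr_fun
    (f := f ∘ₗ tmk F (L.belowCopresheaf n) z a) (g := g ∘ₗ tmk F (L.belowCopresheaf n) z a)
    (belowDeg_hom_ext fun y hy hn c => h y z hy hn a c)

/-- The retraction of `⨁_y F(y) ⊗ Λ_y` onto `F ⊗_P (⨁_{y ≤ •, r(y) = n} Λ_y)`. -/
noncomputable def belowTensorρ (L : GradedDiffModule R P) (n : ℕ) (F : PSh R P) :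
    (⨁ y : P, (F.obj (op y) ⊗[R] L.piece y : Type u)) →ₗ[R]
      tensorObj F (L.belowCopresheaf n) :=
  DirectSum.toModule R P _ fun y => if hn : grade ℕ y = n then
    TensorProduct.lift ((tmk F (L.belowCopresheaf n) y).compl₂ (L.belowOf le_rfl hn)) else 0

/-- A class a ⊗ c, with c in Λ_y and y ≤ z, already comes from the point y as a|_y ⊗ c. The full
direct sum also contains ranks other than `n`, so this is only a retraction. -/
lemma belowTensorρ_ι (L : GradedDiffModule R P) (n : ℕ) (F : PSh R P)
    (t : tensorObj F (L.belowCopresheaf n)) :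
    L.belowTensorρ n F (L.belowTensorι n F t) = t := by
  suffices L.belowTensorρ n F ∘ₗ L.belowTensorι n F = LinearMap.id from LinearMap.congr_fun this t
  refine belowTensor_hom_ext fun y z h hn a c => ?_
  rw [LinearMap.comp_apply, belowTensorι_tmk, belowTensorρ, DirectSum.toModule_lof, dif_pos hn,
    TensorProduct.lift.tmul]
  refine (tmk_res F (L.belowCopresheaf n) h a _).trans ?_
  exact congrArg _ (L.belowCopresheaf_ext_belowOf le_rfl hn h c)

lemma belowTensorι_map (L : GradedDiffModule R P) (n : ℕ) {F F' : PSh R P} (f : F ⟶ F')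
    (t : tensorObj F (L.belowCopresheaf n)) :
    L.belowTensorι n F' (tensorMap f (L.belowCopresheaf n) t) =
      DirectSum.lmap (fun y => LinearMap.rTensor (L.piece y) (f.app (op y)).hom)
        (L.belowTensorι n F t) := by
  suffices L.belowTensorι n F' ∘ₗ tensorMap f (L.belowCopresheaf n) =
      DirectSum.lmap (fun y => LinearMap.rTensor (L.piece y) (f.app (op y)).hom) ∘ₗ
        L.belowTensorι n F from LinearMap.congr_fun this t
  refine belowTensor_hom_ext fun y z h hn a c => ?_
  rw [LinearMap.comp_apply, LinearMap.comp_apply, belowTensorι_tmk]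
  refine (congrArg _ (tensorMap_tmk f (L.belowCopresheaf n) z a (L.belowOf h hn c))).trans ?_
  rw [belowTensorι_tmk, DirectSum.lmap_lof, LinearMap.rTensor_tmul, PSh.res_app]

lemma belowCopresheaf_tensorMap_injective (L : GradedDiffModule R P) (n : ℕ)
    (hL : ∀ y, Module.Flat R (L.piece y)) {F F' : PSh R P} (f : F ⟶ F')
    (hf : ∀ x, Function.Injective (f.app x).hom) :
    Function.Injective (tensorMap f (L.belowCopresheaf n)) := by
  intro s t hst
  have h1 := congrArg (L.belowTensorι n F') hst
  rw [belowTensorι_map, belowTensorι_map] at h1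
  have h2 := (DirectSum.lmap_injective _).2 (fun y =>
    Module.Flat.rTensor_preserves_injective_linearMap (M := L.piece y) _ (hf (op y))) h1
  rw [← L.belowTensorρ_ι n F s, h2, belowTensorρ_ι]

lemma isZero_tor_belowCopresheaf (L : GradedDiffModule R P) (n : ℕ)
    (hL : ∀ y, Module.Flat R (L.piece y)) (F : PSh R P) (i : ℕ) :
    IsZero (Tor (i + 1) F (L.belowCopresheaf n)) :=
  isZero_tor_succ_of_injective _ (L.belowCopresheaf_tensorMap_injective n hL) F i

end GradedDiffModule
end PosetCellular

namespace PosetCellular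

/-! ### Tor_0 against δ_x, generation from below, and dimension shifting -/

section Generation

open scoped Classical

variable {R : Type} [CommRing R] {P : Type u} [PartialOrder P]

/-- The submodule of `G(x)` spanned by the images of the `G(y)` for `y < x`. -/
noncomputable def CoPSh.lower (G : CoPSh R P) (x : P) : Submodule R (G.obj x) :=
  ⨆ y : {y // y < x}, LinearMap.range (G.ext y.1 x)

lemma CoPSh.ext_mem_lower (G : CoPSh R P) {x y : P} (h : y < x) (b : G.obj y) :
    G.ext y x b ∈ G.lower x :=
  le_iSup (fun y : {y // y < x} => LinearMap.range (G.ext y.1 x)) ⟨y, h⟩ ⟨b, rfl⟩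

lemma delta_eq_zero {x y : P} (h : y ≠ x) (c : (delta R x).obj (op y)) : c = 0 :=
  Subtype.ext (deltaValue_eq_zero h c)

lemma subsingleton_delta_tensor (G : CoPSh R P) (x : P) (h : G.lower x = ⊤) :
    Subsingleton (tensorObj (delta R x) G) := by
  suffices (LinearMap.id : tensorObj (delta R x) G →ₗ[R] _) = 0 from
    subsingleton_of_forall_eq 0 fun t => LinearMap.congr_fun this t
  refine tensorObj_hom_ext fun p c b => ?_
  change tmk _ _ _ _ _ = 0
  by_cases hp : p = x
  · subst hp
    have hb : b ∈ G.lower p := h ▸ Submodule.mem_top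
    have hle : G.lower p ≤ LinearMap.ker (tmk (delta R p) G p c) := by
      refine iSup_le fun y => ?_
      rintro _ ⟨b, rfl⟩
      rw [LinearMap.mem_ker, ← tmk_res _ _ y.2.le, delta_eq_zero y.2.ne ((delta R p).res _ _ _),
        map_zero, LinearMap.zero_apply]
    exact hle hb
  · rw [delta_eq_zero hp c, map_zero, LinearMap.zero_apply]

/-- The map from `δ_x R ⊗_P G` to the quotient of `G(x)` by the images of the `G(y)`, `y < x`. -/
noncomputable def deltaTensorMap (G : CoPSh R P) (x : P) :
    tensorObj (delta R x) G →ₗ[R] G.obj x ⧸ G.lower x :=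
  tensorLift (fun p => (LinearMap.toSpanSingleton R _ ((G.lower x).mkQ ∘ₗ G.ext p x)) ∘ₗ
      ULift.moduleEquiv.toLinearMap ∘ₗ (deltaValue R x p).subtype) fun y z h c b => by
    by_cases hz : z = x
    · subst hz
      have e := congrArg ULift.down (deltaRes_apply_coe R z z y c)
      refine (congrArg (· • (G.lower z).mkQ (G.ext y z b)) e).trans ?_
      change _ = ULift.down (show deltaValue R z z from c).1 • (G.lower z).mkQ (G.ext z z _)
      rw [← G.ext_of_le h, G.ext_self]
      by_cases hy : y = z
      · rw [if_pos hy]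
      -- For y < z both sides vanish: restriction in δ_z is zero, and the extension of `b` dies in
      -- the quotient.
      · rw [Submodule.mkQ_apply, (Submodule.Quotient.mk_eq_zero _).2
          (G.ext_mem_lower (lt_of_le_of_ne h hy) b), smul_zero, smul_zero]
    · rw [delta_eq_zero hz c]
      simp

lemma deltaTensorMap_tmk (G : CoPSh R P) (x p : P) (c : deltaValue R x p) (b : G.obj p) :
    deltaTensorMap G x (tmk (delta R x) G p c b) =
      c.1.down • (G.lower x).mkQ (G.ext p x b) :=
  tensorLift_tmk (F := delta R x) _ _ p c b

lemma lower_eq_top (G : CoPSh R P) (x : P) (h : Subsingleton (tensorObj (delta R x) G)) :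
    G.lower x = ⊤ := by
  refine eq_top_iff.2 fun b _ => ?_
  -- Pairing `b` with the generator 1 of δ_x at x recovers the class of `b` in the quotient.
  let e : deltaValue R x x := ⟨⟨1⟩, by simp [deltaValue]⟩
  have h0 : deltaTensorMap G x (tmk (delta R x) G x e b) = 0 :=
    (congrArg _ (Subsingleton.elim _ 0)).trans (map_zero _)
  have h1 := h0.symm.trans (deltaTensorMap_tmk G x x e b)
  rw [one_smul, G.ext_self] at h1
  exact (Submodule.Quotient.mk_eq_zero _).1 h1.symm

lemma isZero_tor_zero_delta_iff (G : CoPSh R P) (x : P) :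
    IsZero (Tor 0 (delta R x) G) ↔ G.lower x = ⊤ := by
  rw [(torZeroIso (delta R x) G).isZero_iff, ModuleCat.isZero_of_iff_subsingleton]
  exact ⟨lower_eq_top G x, subsingleton_delta_tensor G x⟩

lemma lower_eq_top_of_surjective {G G' : CoPSh R P} (g : G ⟶ G') (x : P)
    (hg : Function.Surjective (g.app x).hom) (h : G.lower x = ⊤) : G'.lower x = ⊤ := by
  have h1 : G.lower x ≤ (G'.lower x).comap (g.app x).hom := by
    refine iSup_le fun y => ?_
    rintro _ ⟨b, rfl⟩
    rw [Submodule.mem_comap, CoPSh.ext_app]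
    exact G'.ext_mem_lower y.2 _
  refine eq_top_iff.2 fun b _ => ?_
  obtain ⟨a, rfl⟩ := hg b
  exact h1 (h ▸ Submodule.mem_top)

variable [GradeOrder ℕ P]

/-- A summand Λ_y of rank `n` has y ≠ x, so it already occurs in the value at y < x. -/
lemma GradedDiffModule.lower_belowCopresheaf (L : GradedDiffModule R P) {n : ℕ} {x : P}
    (hx : grade ℕ x ≠ n) : (L.belowCopresheaf n).lower x = ⊤ := by
  refine eq_top_iff.2 fun b _ => ?_
  refine belowDeg_induction (L := L) (p := fun b => b ∈ (L.belowCopresheaf n).lower x)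
    (zero_mem _) (fun _ _ => add_mem) (fun y h hn c => ?_) b
  have hy : y < x := lt_of_le_of_ne h fun h => hx (h ▸ hn)
  have h1 := (L.belowCopresheaf n).ext_mem_lower hy (L.belowOf le_rfl hn c)
  exact (L.belowCopresheaf_ext_belowOf le_rfl hn h c) ▸ h1

/-- A cellular resolution: copresheaves `K_n` and short exact sequences
`0 → K_{n+1} → ⨁_{y ≤ •, r(y) = n} Λ_y → K_n → 0`. -/
structure CellularSteps (K : ℕ → CoPSh R P) (L : ℕ → GradedDiffModule R P) where
  /-- The inclusion of `K_{n+1}`. -/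
  ι : ∀ n, K (n + 1) ⟶ (L n).belowCopresheaf n
  /-- The projection onto `K_n`. -/
  π : ∀ n, (L n).belowCopresheaf n ⟶ K n
  exact : ∀ n, PointwiseShortExact (ι n) (π n)

/-- Dimension shifting, with `n` left free in the induction on `i`: K_n in degree i + 1 is
controlled by K_{n+1} in degree i, because the chains have no higher Tor. In degree 0, K_n is a
quotient of chains generated in rank n. -/
lemma CellularSteps.isZero_tor {K : ℕ → CoPSh R P} {L : ℕ → GradedDiffModule R P}
    (S : CellularSteps K L) (hL : ∀ n y, Module.Flat R ((L n).piece y)) (i : ℕ) :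
    ∀ (n : ℕ) (x : P), i + n ≠ grade ℕ x → IsZero (Tor i (delta R x) (K n)) := by
  induction i with
  | zero =>
    intro n x hx
    rw [isZero_tor_zero_delta_iff]
    exact lower_eq_top_of_surjective (S.π n) x ((S.exact n).surjective x)
      ((L n).lower_belowCopresheaf (by omega))
  | succ i ih =>
    intro n x hx
    exact (S.exact n).isZero_tor_right (ih (n + 1) x (by omega))
      ((L n).isZero_tor_belowCopresheaf n (hL n) _ _)

end Generation
end PosetCellular

namespace PosetCellular

/-! ### Pointwise kernels of copresheaf morphisms -/

section Kernel

variable {R : Type} [CommRing R] {P : Type u} [PartialOrder P]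

/-- The pointwise kernel of a morphism of copresheaves. -/
noncomputable def CoPSh.ker {G G' : CoPSh R P} (g : G ⟶ G') : CoPSh R P where
  obj x := ModuleCat.of R (LinearMap.ker (g.app x).hom)
  map {x y} f := ModuleCat.ofHom ((G.map f).hom.restrict fun a ha => by
    have e : (g.app y).hom ((G.map f).hom a) = (G'.map f).hom ((g.app x).hom a) :=
      congrArg (fun k => k.hom a) (g.naturality f)
    rw [LinearMap.mem_ker] at ha ⊢
    rw [e, ha, map_zero])
  map_id x := by
    refine ModuleCat.hom_ext (LinearMap.ext fun a => Subtype.ext ?_)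
    exact congrArg (fun k => k.hom a.1) (G.map_id x)
  map_comp f f' := by
    refine ModuleCat.hom_ext (LinearMap.ext fun a => Subtype.ext ?_)
    exact congrArg (fun k => k.hom a.1) (G.map_comp f f')

/-- The inclusion of the pointwise kernel. -/
noncomputable def CoPSh.kerι {G G' : CoPSh R P} (g : G ⟶ G') : CoPSh.ker g ⟶ G where
  app _ := ModuleCat.ofHom (Submodule.subtype _)

/-- The factorization through the pointwise kernel. -/
noncomputable def CoPSh.kerLift {G'' G G' : CoPSh R P} (g : G ⟶ G') (f : G'' ⟶ G)
    (h : ∀ x a, (g.app x).hom ((f.app x).hom a) = 0) : G'' ⟶ CoPSh.ker g where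
  app x := ModuleCat.ofHom ((f.app x).hom.codRestrict _ (h x))
  naturality x y k := by
    refine ModuleCat.hom_ext (LinearMap.ext fun a => Subtype.ext ?_)
    exact congrArg (fun k => k.hom a) (f.naturality k)

lemma CoPSh.pointwiseShortExact_ker {G G' G'' : CoPSh R P} (g : G ⟶ G') (p : G ⟶ G'')
    (hp : ∀ x a, (g.app x).hom a = 0 ↔ (p.app x).hom a = 0)
    (hs : ∀ x, Function.Surjective (p.app x).hom) : PointwiseShortExact (CoPSh.kerι g) p where
  injective _ := Subtype.val_injective
  exact x a := ⟨fun ha => ⟨⟨a, (hp x a).2 ha⟩, rfl⟩, by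
    rintro ⟨b, rfl⟩
    exact (hp x _).1 b.2⟩
  surjective := hs

end Kernel

/-! ### Augmented complexes: a resolution forces the Tor condition -/

namespace GradedDiffModule

open scoped Classical

lemma lof_injective {R : Type} [CommRing R] {P : Type u} (L : GradedDiffModule R P) (x : P) :
    Function.Injective (DirectSum.lof R P (fun y => L.piece y) x) :=
  DirectSum.of_injective x

variable {R : Type} [CommRing R] {P : Type u} [PartialOrder P] [GradeOrder ℕ P]

lemma eq_zero_of_grade_lt (L : GradedDiffModule R P) {x : P} {n : ℕ} (h : grade ℕ x < n)
    {a : ⨁ y, L.piece y} (ha : a ∈ L.belowDeg x n) : a = 0 := by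
  refine DFinsupp.ext fun y => by_contra fun hy => ?_
  obtain ⟨h1, h2⟩ := ha y hy
  have := grade_mono (𝕆 := ℕ) h1
  omega

lemma belowOf_surjective (L : GradedDiffModule R P) {x : P} {n : ℕ} (hn : grade ℕ x = n) :
    Function.Surjective (L.belowOf le_rfl hn) := by
  intro a
  refine belowDeg_induction (p := fun a => ∃ c, L.belowOf le_rfl hn c = a) ⟨0, map_zero _⟩ ?_ ?_ a
  · rintro _ _ ⟨a, rfl⟩ ⟨b, rfl⟩
    exact ⟨a + b, map_add _ _ _⟩
  · intro y h hy c
    obtain rfl : y = x := by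
      by_contra hne
      have := grade_strictMono (𝕆 := ℕ) (lt_of_le_of_ne h hne)
      omega
    exact ⟨c, rfl⟩

/-- The differential `⨁_{y ≤ •, r(y) = n + 1} Λ_y ⟶ ⨁_{y ≤ •, r(y) = n} Λ_y`. -/
noncomputable def belowDiff (L : GradedDiffModule R P) (h : L.LowersByCover) (n : ℕ) :
    L.belowCopresheaf (n + 1) ⟶ L.belowCopresheaf n where
  app x := ModuleCat.ofHom (L.d.restrict (p := L.belowDeg x (n + 1)) (q := L.belowDeg x n)
    fun _ => h.d_mem)

/-- An augmentation `ε` making every `Λ_{≤ x}` a resolution of `G(x)`. -/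
structure IsAugmentation (L : GradedDiffModule R P) {G : CoPSh R P}
    (ε : L.belowCopresheaf 0 ⟶ G) : Prop where
  lowers : L.LowersByCover
  surjective : ∀ x, Function.Surjective (ε.app x).hom
  exact_zero : ∀ x (a : L.belowDeg x 0),
    (ε.app x).hom a = 0 ↔ ∃ b ∈ L.belowDeg x 1, L.d b = a
  exact_succ : ∀ x n, ∀ a ∈ L.belowDeg x (n + 1), L.d a = 0 →
    ∃ b ∈ L.belowDeg x (n + 2), L.d b = a

namespace IsAugmentation

variable {L : GradedDiffModule R P} {G : CoPSh R P} {ε : L.belowCopresheaf 0 ⟶ G}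

lemma injective_zero (hε : L.IsAugmentation ε) {x : P} (hx : grade ℕ x = 0) {a : L.piece x}
    (ha : (ε.app x).hom (L.belowOf le_rfl hx a) = 0) : a = 0 := by
  obtain ⟨b, hb, hba⟩ := (hε.exact_zero x _).1 ha
  rw [L.eq_zero_of_grade_lt (by omega) hb, map_zero] at hba
  exact (map_eq_zero_iff _ (L.lof_injective x)).1 hba.symm

/-- A cycle in Λ_x is the boundary of a chain of rank r(x) + 1 below x, and the only such chain is
zero. -/
lemma injective_succ (hε : L.IsAugmentation ε) {x : P} {n : ℕ} (hx : grade ℕ x = n + 1)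
    {a : L.piece x} (ha : L.d (DirectSum.lof R P (fun y => L.piece y) x a) = 0) : a = 0 := by
  obtain ⟨b, hb, hba⟩ := hε.exact_succ x n _ (L.lof_mem_belowDeg le_rfl hx a) ha
  rw [L.eq_zero_of_grade_lt (by omega) hb, map_zero] at hba
  exact (map_eq_zero_iff _ (L.lof_injective x)).1 hba.symm

/-- Λ_x embeds in G(x) in rank 0, and by ∂ in a product of pieces one rank lower otherwise;
torsion-freeness passes to submodules of products. -/
lemma isTorsionFree_piece (hε : L.IsAugmentation ε) (hG : ∀ x, Module.IsTorsionFree R (G.obj x))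
    (n : ℕ) : ∀ x, grade ℕ x = n → Module.IsTorsionFree R (L.piece x) := by
  induction n with
  | zero =>
    intro x hx
    let f : L.piece x →ₗ[R] G.obj x := (ε.app x).hom ∘ₗ L.belowOf le_rfl hx
    have hf : Function.Injective f :=
      (injective_iff_map_eq_zero f).2 fun a => hε.injective_zero hx
    exact hf.moduleIsTorsionFree f (map_smul f)
  | succ n ih =>
    intro x hx
    let f : L.piece x →ₗ[R] ∀ y : {y : P // grade ℕ y = n}, L.piece y.1 :=
      LinearMap.pi fun y => DirectSum.component R P (fun y => L.piece y) y.1 ∘ₗ L.d ∘ₗ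
        DirectSum.lof R P (fun y => L.piece y) x
    have hf : Function.Injective f := by
      refine (injective_iff_map_eq_zero f).2 fun a ha => hε.injective_succ hx ?_
      refine DFinsupp.ext fun y => by_contra fun hy => hy ?_
      have h1 := hε.lowers.d_mem (L.lof_mem_belowDeg le_rfl hx a) y hy
      exact congrFun ha ⟨y, h1.2⟩
    have (y : {y : P // grade ℕ y = n}) := ih y.1 y.2
    exact hf.moduleIsTorsionFree f (map_smul f)

/-- The augmented complex in degree `n - 1`. -/
noncomputable def target (_ : L.IsAugmentation ε) : ℕ → CoPSh R P
  | 0 => G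
  | n + 1 => L.belowCopresheaf n

/-- The differential of the augmented complex. -/
noncomputable def diff (hε : L.IsAugmentation ε) : ∀ n, L.belowCopresheaf n ⟶ hε.target n
  | 0 => ε
  | n + 1 => L.belowDiff hε.lowers n

/-- The copresheaves of cycles of the augmented complex. -/
noncomputable def cycles (hε : L.IsAugmentation ε) : ℕ → CoPSh R P
  | 0 => G
  | n + 1 => CoPSh.ker (hε.diff n)

/-- Since `target` is shifted by one, `diff 0` is the augmentation, and exactness at C_0 and at
higher chains takes one uniform form. -/
lemma diff_eq_zero_iff (hε : L.IsAugmentation ε) (n : ℕ) (x : P) (a : L.belowDeg x n) :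
    ((hε.diff n).app x).hom a = 0 ↔
      ∃ b, ((L.belowDiff hε.lowers n).app x).hom b = a := by
  have key : (∃ b ∈ L.belowDeg x (n + 1), L.d b = a) ↔
      ∃ b, ((L.belowDiff hε.lowers n).app x).hom b = a :=
    ⟨fun ⟨b, hb, h⟩ => ⟨⟨b, hb⟩, Subtype.ext h⟩, fun ⟨b, h⟩ =>
      ⟨(show L.belowDeg x (n + 1) from b).1, (show L.belowDeg x (n + 1) from b).2,
        congrArg Subtype.val h⟩⟩
  rw [← key]
  cases n with
  | zero => exact hε.exact_zero x a
  | succ n =>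
    refine ⟨fun h => hε.exact_succ x n _ a.2 (congrArg Subtype.val h), ?_⟩
    rintro ⟨b, hb, h⟩
    refine Subtype.ext ?_
    change L.d a = 0
    rw [← h]
    exact LinearMap.congr_fun L.d_comp_d b

/-- The projection from chains to cycles of the augmented complex. -/
noncomputable def toCycles (hε : L.IsAugmentation ε) : ∀ n, L.belowCopresheaf n ⟶ hε.cycles n
  | 0 => ε
  | n + 1 => CoPSh.kerLift (hε.diff n) (L.belowDiff hε.lowers n) fun x a =>
    (hε.diff_eq_zero_iff n x _).2 ⟨a, rfl⟩

/-- The short exact sequences of chains and cycles of the augmented complex. -/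
noncomputable def steps (hε : L.IsAugmentation ε) : CellularSteps hε.cycles (fun _ => L) where
  ι n := CoPSh.kerι (hε.diff n)
  π n := hε.toCycles n
  exact n := by
    cases n with
    | zero => exact CoPSh.pointwiseShortExact_ker _ _ (fun _ _ => Iff.rfl) hε.surjective
    | succ n =>
      refine CoPSh.pointwiseShortExact_ker _ _ (fun x a => ⟨fun h => Subtype.ext h,
        fun h => congrArg Subtype.val h⟩) fun x => ?_
      rintro ⟨a, ha⟩
      obtain ⟨b, hb⟩ := (hε.diff_eq_zero_iff n x a).1 ha
      exact ⟨b, Subtype.ext hb⟩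

lemma isHomologicalCellular [IsDedekindDomain R] (hε : L.IsAugmentation ε)
    (hG : ∀ x, Module.IsTorsionFree R (G.obj x)) : IsHomologicalCellular G := fun x i hi =>
  hε.steps.isZero_tor (fun _ y =>
    -- Torsion-free modules over a Dedekind domain are flat.
    have := hε.isTorsionFree_piece hG _ y rfl
    inferInstance) i 0 x hi

end IsAugmentation
end GradedDiffModule
end PosetCellular

namespace PosetCellular

/-! ### Translation between cellular forms and augmentations -/

section HomologyZero

variable {R : Type} [CommRing R]

/-- The projection `K_0 ⟶ H_0(K)`. -/
noncomputable def homologyZeroπ (K : ChainComplex (ModuleCat.{u} R) ℕ) : K.X 0 ⟶ K.homology 0 :=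
  K.pOpcycles 0 ≫ K.isoHomologyι₀.inv

instance (K : ChainComplex (ModuleCat.{u} R) ℕ) : Epi (homologyZeroπ K) := epi_comp _ _

lemma homologyZeroπ_naturality {K K' : ChainComplex (ModuleCat.{u} R) ℕ} (φ : K ⟶ K') :
    φ.f 0 ≫ homologyZeroπ K' = homologyZeroπ K ≫ HomologicalComplex.homologyMap φ 0 := by
  rw [homologyZeroπ, homologyZeroπ, Category.assoc, ChainComplex.isoHomologyι₀_inv_naturality,
    HomologicalComplex.p_opcyclesMap_assoc]

lemma homologyZeroπ_eq_zero_iff (K : ChainComplex (ModuleCat.{u} R) ℕ) (a : K.X 0) :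
    (homologyZeroπ K).hom a = 0 ↔ ∃ b, (K.d 1 0).hom b = a := by
  have hi : Function.Injective K.isoHomologyι₀.inv.hom :=
    (ModuleCat.mono_iff_injective _).1 inferInstance
  -- The incoming differential is indexed by `prev 0`; quantifying over the index allows it to be
  -- replaced by 1.
  have key : ∀ i, (ComplexShape.down ℕ).prev 0 = i → ((K.pOpcycles 0).hom a = 0 ↔
      ∃ b, (K.d i 0).hom b = a) := by
    rintro _ rfl
    exact ShortComplex.moduleCat_pOpcycles_eq_zero_iff (K.sc 0) a
  rw [← key 1 (ChainComplex.prev ℕ 0)]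
  exact map_eq_zero_iff _ hi

end HomologyZero

namespace GradedDiffModule

variable {R : Type} [CommRing R] {P : Type u} [PartialOrder P] [GradeOrder ℕ P]

lemma isZero_homology_below_iff (L : GradedDiffModule R P) (h : L.LowersByCover) (x : P) (n : ℕ) :
    IsZero ((L.below h x).homology (n + 1)) ↔ ∀ a ∈ L.belowDeg x (n + 1), L.d a = 0 →
      ∃ b ∈ L.belowDeg x (n + 2), L.d b = a := by
  rw [← HomologicalComplex.exactAt_iff_isZero_homology,
    HomologicalComplex.exactAt_iff' _ (n + 2) (n + 1) n (ChainComplex.prev ℕ (n + 1))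
      (ChainComplex.next_nat_succ n), ShortComplex.moduleCat_exact_iff]
  change (∀ a : L.belowDeg x (n + 1), ((L.below h x).d (n + 1) n).hom a = 0 →
    ∃ b : L.belowDeg x (n + 2), ((L.below h x).d (n + 2) (n + 1)).hom b = a) ↔ _
  rw [below_d, below_d]
  constructor
  · intro H a ha h0
    obtain ⟨b, hb⟩ := H ⟨a, ha⟩ (Subtype.ext h0)
    exact ⟨b.1, b.2, congrArg Subtype.val hb⟩
  · intro H a h0
    obtain ⟨b, hb, e⟩ := H a.1 a.2 (congrArg Subtype.val h0)
    exact ⟨⟨b, hb⟩, Subtype.ext e⟩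

/-- The projection `⨁_{y ≤ •, r(y) = 0} Λ_y ⟶ H_0(Λ_{≤ •})`. -/
noncomputable def H₀π (L : GradedDiffModule R P) (h : L.LowersByCover) :
    L.belowCopresheaf 0 ⟶ L.H₀ h where
  app x := homologyZeroπ (L.below h x)
  naturality _ _ f := homologyZeroπ_naturality ((L.chains h).map f)

lemma H₀π_surjective (L : GradedDiffModule R P) (h : L.LowersByCover) (x : P) :
    Function.Surjective ((L.H₀π h).app x).hom := by
  exact (ModuleCat.epi_iff_surjective (homologyZeroπ (L.below h x))).1 inferInstance

instance (L : GradedDiffModule R P) (h : L.LowersByCover) : Epi (L.H₀π h) :=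
  have (x : P) : Epi ((L.H₀π h).app x) :=
    (ModuleCat.epi_iff_surjective _).2 (L.H₀π_surjective h x)
  NatTrans.epi_of_epi_app _

lemma H₀π_eq_zero_iff (L : GradedDiffModule R P) (h : L.LowersByCover) (x : P)
    (a : L.belowDeg x 0) :
    ((L.H₀π h).app x).hom a = 0 ↔ ∃ b ∈ L.belowDeg x 1, L.d b = a := by
  refine (homologyZeroπ_eq_zero_iff (L.below h x) a).trans ?_
  rw [below_d]
  exact ⟨fun ⟨b, hb⟩ => ⟨(show L.belowDeg x 1 from b).1, (show L.belowDeg x 1 from b).2,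
    congrArg Subtype.val hb⟩, fun ⟨b, hb, h⟩ => ⟨⟨b, hb⟩, Subtype.ext h⟩⟩

/-- The map `⨁_{y ≤ •, r(y) = n} Λ_y ⟶ ⨁_{y ≤ •, r(y) = n} Λ'_y` induced by a family of
linear maps. -/
noncomputable def belowMap {L L' : GradedDiffModule R P}
    (φ : ∀ x, L.piece x →ₗ[R] L'.piece x) (n : ℕ) :
    L.belowCopresheaf n ⟶ L'.belowCopresheaf n where
  app x := ModuleCat.ofHom ((DirectSum.lmap φ).restrict (p := L.belowDeg x n)
    (q := L'.belowDeg x n) fun _ ha y hy => ha y fun h => hy (by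
      rw [DirectSum.lmap_apply, h, map_zero]))

lemma H₀π_naturality {L L' : GradedDiffModule R P} (f : L ⟶ L') (h : L.LowersByCover)
    (h' : L'.LowersByCover) : L.H₀π h ≫ H₀Map f h h' = belowMap (Hom.app f) 0 ≫ L'.H₀π h' := by
  exact NatTrans.ext (funext fun x => (homologyZeroπ_naturality ((chainsMap f h h').app x)).symm)

end GradedDiffModule

open GradedDiffModule

variable {R : Type} [CommRing R] {P : Type u} [PartialOrder P] [GradeOrder ℕ P] {G : CoPSh R P}

/-- The augmentation of a cellular form. -/
noncomputable def CellularForm.augmentation (L : CellularForm G) :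
    L.toGradedDiffModule.belowCopresheaf 0 ⟶ G :=
  L.toGradedDiffModule.H₀π L.lowers ≫ L.iso.hom

lemma CellularForm.isAugmentation (L : CellularForm G) :
    L.toGradedDiffModule.IsAugmentation L.augmentation where
  lowers := L.lowers
  surjective x := by
    have : Function.Surjective (L.iso.hom.app x).hom :=
      (ModuleCat.epi_iff_surjective _).1 inferInstance
    exact this.comp (L.toGradedDiffModule.H₀π_surjective L.lowers x)
  exact_zero x a := by
    have : Function.Injective (L.iso.hom.app x).hom :=
      (ModuleCat.mono_iff_injective _).1 inferInstance
    rw [← H₀π_eq_zero_iff _ L.lowers]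
    exact map_eq_zero_iff _ this
  exact_succ x n := (isZero_homology_below_iff _ L.lowers x n).1 (L.acyclic x _ n.succ_pos)

/-- Chains of rank 0 project epimorphically onto H_0, so compatibility on H_0 can be tested on
chains. -/
lemma CellularForm.H₀Map_comp_iff (L L' : CellularForm G)
    (f : L.toGradedDiffModule ⟶ L'.toGradedDiffModule) :
    H₀Map f L.lowers L'.lowers ≫ L'.iso.hom = L.iso.hom ↔
      belowMap (Hom.app f) 0 ≫ L'.augmentation = L.augmentation := by
  rw [← cancel_epi (L.toGradedDiffModule.H₀π L.lowers), ← Category.assoc, H₀π_naturality,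
    Category.assoc]
  rfl

/-- The map out of `H_0(Λ_{≤ x})` induced by an augmentation. -/
noncomputable def GradedDiffModule.IsAugmentation.descH₀App {L : GradedDiffModule R P}
    {ε : L.belowCopresheaf 0 ⟶ G} (hε : L.IsAugmentation ε) (x : P) :
    (L.H₀ hε.lowers).obj x ⟶ G.obj x :=
  ModuleCat.ofHom (((LinearMap.ker ((L.H₀π hε.lowers).app x).hom).liftQ (ε.app x).hom
    fun a ha => (hε.exact_zero x a).2 ((L.H₀π_eq_zero_iff hε.lowers x a).1 ha)) ∘ₗ
      (((L.H₀π hε.lowers).app x).hom.quotKerEquivOfSurjective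
        (L.H₀π_surjective _ x)).symm.toLinearMap)

lemma GradedDiffModule.IsAugmentation.descH₀App_π {L : GradedDiffModule R P}
    {ε : L.belowCopresheaf 0 ⟶ G} (hε : L.IsAugmentation ε) (x : P) (a) :
    (hε.descH₀App x).hom (((L.H₀π hε.lowers).app x).hom a) = (ε.app x).hom a := by
  have h := LinearMap.quotKerEquivOfSurjective_symm_apply ((L.H₀π hε.lowers).app x).hom
    (L.H₀π_surjective _ x) a
  exact congrArg (Submodule.liftQ _ (ε.app x).hom fun a ha =>
    (hε.exact_zero x a).2 ((L.H₀π_eq_zero_iff hε.lowers x a).1 ha)) h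

/-- The isomorphism `H_0(Λ_{≤ •}) ≅ G` induced by an augmentation. -/
noncomputable def GradedDiffModule.IsAugmentation.isoH₀ {L : GradedDiffModule R P}
    {ε : L.belowCopresheaf 0 ⟶ G} (hε : L.IsAugmentation ε) : L.H₀ hε.lowers ≅ G :=
  have (x : P) : IsIso (hε.descH₀App x) := by
    refine (ConcreteCategory.isIso_iff_bijective _).2 ⟨?_, fun b => ?_⟩
    · refine (injective_iff_map_eq_zero (hε.descH₀App x).hom).2 fun t ht => ?_
      obtain ⟨a, rfl⟩ := L.H₀π_surjective hε.lowers x t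
      rw [hε.descH₀App_π] at ht
      exact (L.H₀π_eq_zero_iff hε.lowers x a).2 ((hε.exact_zero x a).1 ht)
    · obtain ⟨a, ha⟩ := hε.surjective x b
      exact ⟨_, (hε.descH₀App_π x a).trans ha⟩
  NatIso.ofComponents (fun x => asIso (hε.descH₀App x)) fun {x y} f => by
    refine ModuleCat.hom_ext (LinearMap.ext fun t => ?_)
    obtain ⟨a, rfl⟩ := L.H₀π_surjective hε.lowers x t
    have h1 := congrArg (fun k => k.hom a) ((L.H₀π hε.lowers).naturality f)
    have h2 := congrArg (fun k => k.hom a) (ε.naturality f)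
    have h3 := congrArg (hε.descH₀App y).hom h1
    refine h3.symm.trans (((hε.descH₀App_π y _).trans h2).trans ?_)
    exact congrArg (G.map f).hom (hε.descH₀App_π x a).symm

/-- The cellular form given by an augmented `P`-graded differential module. -/
noncomputable def GradedDiffModule.IsAugmentation.cellularForm {L : GradedDiffModule R P}
    {ε : L.belowCopresheaf 0 ⟶ G} (hε : L.IsAugmentation ε) : CellularForm G where
  toGradedDiffModule := L
  lowers := hε.lowers
  acyclic x n hn := by
    obtain ⟨n, rfl⟩ := Nat.exists_eq_succ_of_ne_zero hn.ne'
    exact (L.isZero_homology_below_iff hε.lowers x n).2 (hε.exact_succ x n)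
  iso := hε.isoH₀

end PosetCellular

/-! ### Construction of a cellular form from iterated syzygies -/

namespace PosetCellular

open scoped Classical
open GradedDiffModule

variable {R : Type} [CommRing R] {P : Type u} [PartialOrder P]

/-- The values of a copresheaf as a graded module with zero differential. -/
noncomputable def CoPSh.values (G : CoPSh R P) : GradedDiffModule R P where
  piece x := G.obj x
  d := 0
  d_comp_d := by simp

variable [GradeOrder ℕ P]

/-- The canonical map `⨁_{y ≤ x, r(y) = n} G(y) → G(x)`. -/
noncomputable def CoPSh.sumMap (G : CoPSh R P) (n : ℕ) : G.values.belowCopresheaf n ⟶ G where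
  app x := ModuleCat.ofHom (DirectSum.toModule R P _ (fun y => G.ext y x) ∘ₗ
    (G.values.belowDeg x n).subtype)
  naturality x x' f := by
    refine ModuleCat.hom_ext (belowDeg_hom_ext fun y h hn c => ?_)
    change DirectSum.toModule R P _ (fun y => G.ext y x') (DirectSum.lof R P
        (fun y => G.values.piece y) y c) =
      (G.map f).hom (DirectSum.toModule R P _ (fun y => G.ext y x)
        (DirectSum.lof R P (fun y => G.values.piece y) y c))
    refine (DirectSum.toModule_lof R (M := fun y => G.obj y) y c).trans
      (Eq.trans ?_ (congrArg (G.map f).hom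
        (DirectSum.toModule_lof R (M := fun y => G.obj y) y c)).symm)
    refine (G.ext_ext h (leOfHom f) c).symm.trans ?_
    rw [G.ext_of_le (leOfHom f)]
    rfl

lemma CoPSh.sumMap_belowOf (G : CoPSh R P) {n : ℕ} {x y : P} (h : y ≤ x) (hn : grade ℕ y = n)
    (c : G.obj y) : ((G.sumMap n).app x).hom (G.values.belowOf h hn c) = G.ext y x c :=
  DirectSum.toModule_lof R (M := fun y => G.obj y) (φ := fun y => G.ext y x) y c

/-- The kernel of `⨁_{y ≤ x, r(y) = n} G(y) → G(x)`. -/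
noncomputable def CoPSh.syzygy (G : CoPSh R P) (n : ℕ) : CoPSh R P := CoPSh.ker (G.sumMap n)

/-- `Tor_i(δ_x R, G)` vanishes for `i + n` different from the rank of `x`. -/
def CoPSh.IsCellularFrom (G : CoPSh R P) (n : ℕ) : Prop :=
  ∀ (x : P) (i : ℕ), i + n ≠ grade ℕ x → IsZero (Tor i (delta R x) G)

/-- At rank `n` the module G(x) is itself a summand. At any other rank vanishing of Tor_0 says G(x)
is spanned by images from below, which are in the range by induction. -/
lemma CoPSh.IsCellularFrom.surjective {G : CoPSh R P} {n : ℕ} (hG : G.IsCellularFrom n) (m : ℕ) :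
    ∀ x, grade ℕ x = m → Function.Surjective ((G.sumMap n).app x).hom := by
  induction m using Nat.strong_induction_on with
  | _ m ih =>
    intro x hx
    by_cases hn : m = n
    · subst hn
      exact fun a => ⟨_, (G.sumMap_belowOf le_rfl hx a).trans (G.ext_self x a)⟩
    · have h1 := (isZero_tor_zero_delta_iff G x).1 (hG x 0 (by omega))
      rw [← LinearMap.range_eq_top, eq_top_iff, ← h1]
      refine iSup_le fun y => ?_
      rintro _ ⟨b, rfl⟩
      obtain ⟨c, rfl⟩ := ih _ (hx ▸ grade_strictMono y.2) y.1 rfl b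
      exact ⟨_, CoPSh.ext_app (G.sumMap n) y.1 x c⟩

lemma CoPSh.pointwiseShortExact_syzygy {G : CoPSh R P} {n : ℕ} (hG : G.IsCellularFrom n) :
    PointwiseShortExact (CoPSh.kerι (G.sumMap n)) (G.sumMap n) :=
  CoPSh.pointwiseShortExact_ker _ _ (fun _ _ => Iff.rfl) fun x => hG.surjective _ x rfl

/-- Tor_i of the syzygy lies between Tor_{i+1} of G and Tor_i of the chains. The latter is known to
vanish unless i = 0 and r(x) = n; in that case the sum map at x is the identity of G(x), so the
syzygy itself is zero at x. -/
lemma CoPSh.IsCellularFrom.syzygy {G : CoPSh R P} {n : ℕ} (hG : G.IsCellularFrom n)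
    (hf : ∀ x, Module.Flat R (G.obj x)) : (G.syzygy n).IsCellularFrom (n + 1) := by
  intro x i hi
  have hs := CoPSh.pointwiseShortExact_syzygy hG
  by_cases hx : i = 0 ∧ grade ℕ x = n
  · obtain ⟨rfl, hx⟩ := hx
    rw [isZero_tor_zero_delta_iff, eq_top_iff]
    rintro ⟨a, ha⟩ -
    suffices a = 0 by
      subst this
      exact zero_mem _
    obtain ⟨c, rfl⟩ := G.values.belowOf_surjective hx a
    have h1 : c = 0 := (G.ext_self x c).symm.trans ((G.sumMap_belowOf le_rfl hx c).symm.trans ha)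
    rw [h1, map_zero]
    rfl
  · refine hs.isZero_tor_left (hG x (i + 1) (by omega)) ?_
    cases i with
    | zero =>
      exact (isZero_tor_zero_delta_iff _ x).2
        (G.values.lower_belowCopresheaf fun h => hx ⟨rfl, h⟩)
    | succ i => exact G.values.isZero_tor_belowCopresheaf n hf _ i

lemma CoPSh.isTorsionFree_syzygy {G : CoPSh R P} (n : ℕ)
    (hf : ∀ x, Module.IsTorsionFree R (G.obj x)) (x : P) :
    Module.IsTorsionFree R ((G.syzygy n).obj x) := by
  let f : (G.syzygy n).obj x →ₗ[R] ∀ y, G.obj y :=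
    DFinsupp.coeFnLinearMap R ∘ₗ (G.values.belowDeg x n).subtype ∘ₗ Submodule.subtype _
  have h : Function.Injective f :=
    (DFunLike.coe_injective.comp Subtype.val_injective).comp Subtype.val_injective
  exact h.moduleIsTorsionFree f (map_smul f)

/-- The iterated syzygies of a copresheaf. -/
noncomputable def syzygies (G : CoPSh R P) : ℕ → CoPSh R P
  | 0 => G
  | n + 1 => (syzygies G n).syzygy n

lemma isTorsionFree_syzygies {G : CoPSh R P} (hf : ∀ x, Module.IsTorsionFree R (G.obj x)) :
    ∀ n x, Module.IsTorsionFree R ((syzygies G n).obj x)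
  | 0 => hf
  | n + 1 => CoPSh.isTorsionFree_syzygy n (isTorsionFree_syzygies hf n)

lemma isCellularFrom_syzygies [IsDedekindDomain R] {G : CoPSh R P}
    (hf : ∀ x, Module.IsTorsionFree R (G.obj x)) (hG : IsHomologicalCellular G) :
    ∀ n, (syzygies G n).IsCellularFrom n
  | 0 => hG
  | n + 1 => (isCellularFrom_syzygies hf hG n).syzygy fun x =>
    have := isTorsionFree_syzygies hf n x
    inferInstance

/-- The identification of the value at `y` of the syzygy of index `n`, for `n` the rank of `y`. -/
noncomputable def gradeCast (G : CoPSh R P) (n : ℕ) (y : P) :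
    (syzygies G n).obj y →ₗ[R] (syzygies G (grade ℕ y)).obj y :=
  -- The value 0 off rank `n` makes the family total in `y`, so that it can be summed; chains of
  -- rank `n` never see it.
  if h : grade ℕ y = n then by subst h; exact LinearMap.id else 0

lemma gradeCast_self (G : CoPSh R P) (y : P) : gradeCast G (grade ℕ y) y = LinearMap.id :=
  dif_pos rfl

lemma gradeCast_bijective (G : CoPSh R P) {n : ℕ} {y : P} (h : grade ℕ y = n) :
    Function.Bijective (gradeCast G n y) := by
  subst h
  rw [gradeCast_self]
  exact Function.bijective_id

/-- The sum of the identifications `gradeCast`. -/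
noncomputable def gradeCastSum (G : CoPSh R P) (n : ℕ) :
    (⨁ y, (syzygies G n).values.piece y) →ₗ[R] ⨁ y, (syzygies G (grade ℕ y)).obj y :=
  DirectSum.lmap (gradeCast G n)

/-- The inclusion of the syzygy of index `n` in the chains of degree `n - 1`. -/
noncomputable def syzygyBoundary (G : CoPSh R P) : ∀ (n : ℕ) (x : P),
    (syzygies G n).obj x →ₗ[R] ⨁ y, (syzygies G (grade ℕ y)).obj y
  | 0, _ => 0
  | n + 1, x => gradeCastSum G n ∘ₗ ((syzygies G n).values.belowDeg x n).subtype ∘ₗ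
      ((CoPSh.kerι ((syzygies G n).sumMap n)).app x).hom

lemma syzygyBoundary_ext (G : CoPSh R P) (n : ℕ) {x y : P} (h : y ≤ x)
    (a : (syzygies G n).obj y) :
    syzygyBoundary G n x ((syzygies G n).ext y x a) = syzygyBoundary G n y a := by
  cases n with
  | zero => rfl
  | succ n =>
    rw [CoPSh.ext_of_le _ h]
    rfl

/-- The differential of the cellular form constructed from the syzygies. -/
noncomputable def syzygyDiff (G : CoPSh R P) :
    (⨁ y, (syzygies G (grade ℕ y)).obj y) →ₗ[R] ⨁ y, (syzygies G (grade ℕ y)).obj y :=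
  DirectSum.toModule R P _ fun x => syzygyBoundary G (grade ℕ x) x

lemma syzygyDiff_lof (G : CoPSh R P) (x : P) (a : (syzygies G (grade ℕ x)).obj x) :
    syzygyDiff G (DirectSum.lof R P (fun y => (syzygies G (grade ℕ y)).obj y) x a) =
      syzygyBoundary G (grade ℕ x) x a :=
  DirectSum.toModule_lof R (M := fun y => (syzygies G (grade ℕ y)).obj y) x a

lemma gradeCastSum_belowOf (G : CoPSh R P) {n : ℕ} {x y : P} (h : y ≤ x) (hn : grade ℕ y = n)
    (c : (syzygies G n).obj y) :
    gradeCastSum G n ((syzygies G n).values.belowOf h hn c).1 =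
      DirectSum.lof R P (fun y => (syzygies G (grade ℕ y)).obj y) y (gradeCast G n y c) :=
  DirectSum.lmap_lof (gradeCast G n) y c

/-- On chains of rank `n` the differential is the splice of the sum map onto G_n with the inclusion
of G_n in chains of rank n - 1 (zero for n = 0). -/
lemma syzygyDiff_gradeCastSum (G : CoPSh R P) (n : ℕ) (x : P)
    (b : (syzygies G n).values.belowDeg x n) :
    syzygyDiff G (gradeCastSum G n b.1) =
      syzygyBoundary G n x ((((syzygies G n).sumMap n).app x).hom b) := by
  revert b
  refine LinearMap.congr_fun
    (f := syzygyDiff G ∘ₗ gradeCastSum G n ∘ₗ ((syzygies G n).values.belowDeg x n).subtype)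
    (g := syzygyBoundary G n x ∘ₗ (((syzygies G n).sumMap n).app x).hom)
    (belowDeg_hom_ext fun y h hn c => ?_)
  refine (congrArg (syzygyDiff G) (gradeCastSum_belowOf G h hn c)).trans ?_
  refine Eq.trans ?_ (congrArg (syzygyBoundary G n x)
    ((syzygies G n).sumMap_belowOf h hn c)).symm
  refine (syzygyDiff_lof G y _).trans (Eq.trans ?_ (syzygyBoundary_ext G n h c).symm)
  subst hn
  exact congrArg _ (LinearMap.congr_fun (gradeCast_self G y) c)

/-- An element of G_{n+1} is a chain killed by the sum map, through which the differential factors;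
hence ∂² = 0. -/
lemma syzygyDiff_boundary (G : CoPSh R P) (n : ℕ) (x : P) (a : (syzygies G n).obj x) :
    syzygyDiff G (syzygyBoundary G n x a) = 0 := by
  cases n with
  | zero => exact map_zero _
  | succ n =>
    refine (syzygyDiff_gradeCastSum G n x _).trans ?_
    exact (congrArg (syzygyBoundary G n x) a.2).trans (map_zero _)

/-- The `P`-graded differential module constructed from the syzygies of `G`. -/
noncomputable def syzygyModule (G : CoPSh R P) : GradedDiffModule R P where
  piece x := (syzygies G (grade ℕ x)).obj x
  d := syzygyDiff G
  d_comp_d := by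
    refine DirectSum.linearMap_ext R fun x => LinearMap.ext fun a => ?_
    refine (congrArg (syzygyDiff G) (syzygyDiff_lof G x a)).trans ?_
    exact syzygyDiff_boundary G _ x a

/-- The identification of chains of degree `n` with sums of values of syzygies. -/
noncomputable def syzygyChains (G : CoPSh R P) (n : ℕ) :
    (syzygies G n).values.belowCopresheaf n ⟶ (syzygyModule G).belowCopresheaf n where
  app x := ModuleCat.ofHom ((gradeCastSum G n).restrict (q := (syzygyModule G).belowDeg x n)
    fun a ha y hy => ha y fun h => hy ((congrArg (gradeCast G n y) h).trans (map_zero _)))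

lemma syzygyChains_bijective (G : CoPSh R P) (n : ℕ) (x : P) :
    Function.Bijective ((syzygyChains G n).app x).hom := by
  constructor
  · refine (injective_iff_map_eq_zero ((syzygyChains G n).app x).hom).2 fun a ha => ?_
    refine Subtype.ext (DFinsupp.ext fun y => by_contra fun hy => hy ?_)
    obtain ⟨-, hn⟩ := a.2 y hy
    have h1 : gradeCast G n y (a.1 y) = 0 := DFunLike.congr_fun (congrArg Subtype.val ha) y
    exact (map_eq_zero_iff _ (gradeCast_bijective G hn).1).1 h1
  · refine belowDeg_induction (L := syzygyModule G)
      (p := fun b => ∃ a, ((syzygyChains G n).app x).hom a = b) ⟨0, map_zero _⟩ ?_ ?_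
    · rintro _ _ ⟨a, rfl⟩ ⟨b, rfl⟩
      exact ⟨a + b, map_add _ _ _⟩
    · intro y h hn c
      obtain ⟨c, rfl⟩ := (gradeCast_bijective G hn).2 c
      exact ⟨(syzygies G n).values.belowOf h hn c,
        Subtype.ext (gradeCastSum_belowOf G h hn c)⟩

lemma covBy_of_grade_eq_add_one {x y : P} (h : y ≤ x) (hg : grade ℕ x = grade ℕ y + 1) : y ⋖ x := by
  refine ⟨lt_of_le_of_ne h fun h => by subst h; omega, fun z hyz hzx => ?_⟩
  have h1 := grade_strictMono (𝕆 := ℕ) hyz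
  have h2 := grade_strictMono (𝕆 := ℕ) hzx
  omega

lemma syzygyModule_lowersByCover (G : CoPSh R P) : (syzygyModule G).LowersByCover := by
  have key (n : ℕ) (x y : P) (hx : grade ℕ x = n) (a : (syzygies G n).obj x)
      (h : syzygyBoundary G n x a y ≠ 0) : y ⋖ x := by
    cases n with
    | zero => exact absurd rfl h
    | succ n =>
      obtain ⟨h1, h2⟩ := a.1.2 y fun h0 => h ((congrArg (gradeCast G n y) h0).trans (map_zero _))
      exact covBy_of_grade_eq_add_one h1 (by omega)
  intro x a y hy
  exact key _ x y rfl a fun h => hy ((DFunLike.congr_fun (syzygyDiff_lof G x a) y).trans h)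

/-- The augmentation of the module constructed from the syzygies of `G`. -/
noncomputable def syzygyAugmentation (G : CoPSh R P) :
    (syzygyModule G).belowCopresheaf 0 ⟶ G :=
  have (x : P) : IsIso ((syzygyChains G 0).app x) :=
    (ConcreteCategory.isIso_iff_bijective _).2 (syzygyChains_bijective G 0 x)
  have : IsIso (syzygyChains G 0) := NatIso.isIso_of_isIso_app _
  inv (syzygyChains G 0) ≫ G.sumMap 0

lemma syzygyAugmentation_chains (G : CoPSh R P) (x : P) (b : G.values.belowDeg x 0) :
    ((syzygyAugmentation G).app x).hom (((syzygyChains G 0).app x).hom b) =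
      ((G.sumMap 0).app x).hom b := by
  have (x : P) : IsIso ((syzygyChains G 0).app x) :=
    (ConcreteCategory.isIso_iff_bijective _).2 (syzygyChains_bijective G 0 x)
  have : IsIso (syzygyChains G 0) := NatIso.isIso_of_isIso_app _
  exact congrArg (fun f => (f.app x).hom b) (IsIso.hom_inv_id_assoc (syzygyChains G 0) (G.sumMap 0))

lemma syzygyAugmentation_isAugmentation [IsDedekindDomain R] {G : CoPSh R P}
    (hf : ∀ x, Module.IsTorsionFree R (G.obj x)) (hG : IsHomologicalCellular G) :
    (syzygyModule G).IsAugmentation (syzygyAugmentation G) := by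
  have hS (n) := isCellularFrom_syzygies hf hG n
  -- Exactness in all degrees at once: the kernel of the sum map is G_{n+1} by definition, and the
  -- next sum map is onto G_{n+1}.
  have key (n : ℕ) (x : P) (b : (syzygies G n).values.belowDeg x n) :
      (((syzygies G n).sumMap n).app x).hom b = 0 ↔
        ∃ c ∈ (syzygyModule G).belowDeg x (n + 1),
          (syzygyModule G).d c = gradeCastSum G n b.1 := by
    constructor
    · intro hb
      obtain ⟨c, hc⟩ := (hS (n + 1)).surjective _ x rfl ⟨b, hb⟩
      refine ⟨_, (((syzygyChains G (n + 1)).app x).hom c).2, ?_⟩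
      refine (syzygyDiff_gradeCastSum G (n + 1) x c).trans ?_
      rw [hc]
      rfl
    · rintro ⟨c, hc, h⟩
      obtain ⟨c', hc'⟩ := (syzygyChains_bijective G (n + 1) x).2 ⟨c, hc⟩
      obtain rfl : gradeCastSum G (n + 1) c'.1 = c := congrArg Subtype.val hc'
      have h1 := (syzygyDiff_gradeCastSum G (n + 1) x c').symm.trans h
      let s := (((syzygies G (n + 1)).sumMap (n + 1)).app x).hom c'
      have h2 : s.1 = b := (syzygyChains_bijective G n x).1 (Subtype.ext h1)
      exact h2 ▸ s.2
  refine ⟨syzygyModule_lowersByCover G, fun x a => ?_, fun x a => ?_, fun x n a ha h0 => ?_⟩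
  · obtain ⟨b, hb⟩ := (hS 0).surjective _ x rfl a
    exact ⟨_, (syzygyAugmentation_chains G x b).trans hb⟩
  · obtain ⟨b, rfl⟩ := (syzygyChains_bijective G 0 x).2 a
    refine Iff.trans ?_ (key 0 x b)
    exact iff_of_eq (congrArg (· = 0) (syzygyAugmentation_chains G x b))
  · obtain ⟨b, hb⟩ := (syzygyChains_bijective G (n + 1) x).2 ⟨a, ha⟩
    obtain rfl : gradeCastSum G (n + 1) b.1 = a := congrArg Subtype.val hb
    refine (key (n + 1) x b).1 ?_
    have h1 := (syzygyDiff_gradeCastSum G (n + 1) x b).symm.trans h0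
    -- The inclusion of G_{n+1} in chains is injective, so ∂ = 0 on `b` means that the sum map kills
    -- `b`.
    exact Subtype.ext ((syzygyChains_bijective G n x).1 (a₂ := 0)
      (Subtype.ext (h1.trans (map_zero (gradeCastSum G n)).symm)))

end PosetCellular

/-! ### Comparison of augmented complexes and uniqueness -/

namespace PosetCellular

open scoped Classical

/-- The factorization of `f` through the injective map `d`, if it exists. -/
noncomputable def liftThrough {R A B C : Type*} [CommRing R] [AddCommGroup A] [AddCommGroup B]
    [AddCommGroup C] [Module R A] [Module R B] [Module R C] (d : A →ₗ[R] B) (f : C →ₗ[R] B) :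
    C →ₗ[R] A :=
  if h : Function.Injective d ∧ ∀ c, f c ∈ LinearMap.range d then
    (LinearEquiv.ofInjective d h.1).symm.toLinearMap ∘ₗ f.codRestrict _ h.2
  else 0

lemma apply_liftThrough {R A B C : Type*} [CommRing R] [AddCommGroup A] [AddCommGroup B]
    [AddCommGroup C] [Module R A] [Module R B] [Module R C] {d : A →ₗ[R] B} {f : C →ₗ[R] B}
    (hd : Function.Injective d) (hf : ∀ c, f c ∈ LinearMap.range d) (c : C) :
    d (liftThrough d f c) = f c := by
  rw [liftThrough, dif_pos ⟨hd, hf⟩]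
  exact congrArg Subtype.val ((LinearEquiv.ofInjective d hd).apply_symm_apply ⟨f c, hf c⟩)

namespace GradedDiffModule

variable {R : Type} [CommRing R] {P : Type u} [PartialOrder P] [GradeOrder ℕ P]
  {L L' : GradedDiffModule R P}

lemma lmap_eq_of_mem_belowDeg {φ ψ : ∀ x, L.piece x →ₗ[R] L'.piece x} {n : ℕ}
    (h : ∀ x, grade ℕ x = n → φ x = ψ x) {x : P} {a : ⨁ x, L.piece x}
    (ha : a ∈ L.belowDeg x n) : DirectSum.lmap φ a = DirectSum.lmap ψ a := by
  refine DFinsupp.ext fun y => ?_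
  change φ y (a y) = ψ y (a y)
  by_cases hy : a y = 0
  · rw [hy, map_zero, map_zero]
  · rw [h y (ha y hy).2]

lemma LowersByCover.d_lof_eq_zero (h : L.LowersByCover) {x : P} (hx : grade ℕ x = 0)
    (a : L.piece x) : L.d (DirectSum.lof R P (fun y => L.piece y) x a) = 0 := by
  refine DFinsupp.ext fun y => by_contra fun hy => ?_
  have := grade_strictMono (𝕆 := ℕ) (h x a y hy).lt
  omega

namespace IsAugmentation

variable {G : CoPSh R P} {ε : L.belowCopresheaf 0 ⟶ G} {ε' : L'.belowCopresheaf 0 ⟶ G}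

/-- The comparison maps between augmented modules, valid on the elements of rank `n`. -/
noncomputable def compareRank (ε : L.belowCopresheaf 0 ⟶ G) (ε' : L'.belowCopresheaf 0 ⟶ G) :
    ℕ → ∀ x, L.piece x →ₗ[R] L'.piece x
  | 0, x => if h : grade ℕ x = 0 then
      liftThrough ((ε'.app x).hom ∘ₗ L'.belowOf le_rfl h) ((ε.app x).hom ∘ₗ L.belowOf le_rfl h)
    else 0
  | n + 1, x => liftThrough (L'.d ∘ₗ DirectSum.lof R P (fun y => L'.piece y) x)
      (DirectSum.lmap (compareRank ε ε' n) ∘ₗ L.d ∘ₗ DirectSum.lof R P (fun y => L.piece y) x)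

/-- The comparison maps between augmented modules. -/
noncomputable def compare (ε : L.belowCopresheaf 0 ⟶ G) (ε' : L'.belowCopresheaf 0 ⟶ G) (x : P) :
    L.piece x →ₗ[R] L'.piece x :=
  compareRank ε ε' (grade ℕ x) x

lemma belowOf_app {x : P} {n : ℕ} (φ : ∀ x, L.piece x →ₗ[R] L'.piece x) {y : P} (h : y ≤ x)
    (hn : grade ℕ y = n) (a : L.piece y) :
    ((belowMap φ n).app x).hom (L.belowOf h hn a) = L'.belowOf h hn (φ y a) :=
  Subtype.ext (DirectSum.lmap_lof φ y a)

/-- At x of rank 0 the augmentation of L' is an isomorphism from Λ'_x onto G(x), so the lift exists;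
naturality of both augmentations spreads the identity to all x. -/
lemma compare_augmentation (ε : L.belowCopresheaf 0 ⟶ G) (hε' : L'.IsAugmentation ε') :
    belowMap (compare ε ε') 0 ≫ ε' = ε := by
  have key {x : P} (hx : grade ℕ x = 0) (a : L.piece x) :
      (ε'.app x).hom (L'.belowOf le_rfl hx (compare ε ε' x a)) =
        (ε.app x).hom (L.belowOf le_rfl hx a) := by
    rw [compare, hx, compareRank, dif_pos hx]
    refine apply_liftThrough (d := (ε'.app x).hom ∘ₗ L'.belowOf le_rfl hx)
      (f := (ε.app x).hom ∘ₗ L.belowOf le_rfl hx)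
      ((injective_iff_map_eq_zero _).2 fun a => hε'.injective_zero hx) (fun a => ?_) a
    obtain ⟨b, hb⟩ := hε'.surjective x ((ε.app x).hom (L.belowOf le_rfl hx a))
    obtain ⟨c, rfl⟩ := L'.belowOf_surjective hx b
    exact ⟨c, hb⟩
  refine NatTrans.ext (funext fun x => ModuleCat.hom_ext (belowDeg_hom_ext fun y h hy a => ?_))
  have h1 := CoPSh.ext_app ε' y x (L'.belowOf le_rfl hy (compare ε ε' y a))
  have h2 := CoPSh.ext_app ε y x (L.belowOf le_rfl hy a)
  have h3 := L'.belowCopresheaf_ext_belowOf le_rfl hy h (compare ε ε' y a)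
  have h4 := L.belowCopresheaf_ext_belowOf le_rfl hy h a
  refine (congrArg (ε'.app x).hom (belowOf_app (compare ε ε') h hy a)).trans ?_
  refine (congrArg (ε'.app x).hom h3).symm.trans (h1.trans ?_)
  rw [key hy a]
  exact h2.symm.trans (congrArg (ε.app x).hom h4)

/-- Any primitive in rank n + 1 below x must lie in Λ'_x, since r(x) = n + 1; so its mere existence
makes the lift defining `compare` at x genuine. -/
lemma d_compare_of_exists (hε : L.IsAugmentation ε) (hε' : L'.IsAugmentation ε') {n : ℕ} {x : P}
    (hx : grade ℕ x = n + 1) (h : ∀ a : L.piece x, ∃ b ∈ L'.belowDeg x (n + 1), L'.d b =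
      DirectSum.lmap (compare ε ε') (L.d (DirectSum.lof R P (fun y => L.piece y) x a)))
    (a : L.piece x) :
    L'.d (DirectSum.lof R P (fun y => L'.piece y) x (compare ε ε' x a)) =
      DirectSum.lmap (compare ε ε') (L.d (DirectSum.lof R P (fun y => L.piece y) x a)) := by
  have e (a : L.piece x) : DirectSum.lmap (compareRank ε ε' n)
        (L.d (DirectSum.lof R P (fun y => L.piece y) x a)) =
      DirectSum.lmap (compare ε ε') (L.d (DirectSum.lof R P (fun y => L.piece y) x a)) :=
    lmap_eq_of_mem_belowDeg (fun y hy => by rw [compare, hy])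
      (hε.lowers.d_mem (L.lof_mem_belowDeg le_rfl hx a))
  rw [← e, compare, hx, compareRank]
  refine apply_liftThrough (d := L'.d ∘ₗ DirectSum.lof R P (fun y => L'.piece y) x)
    (f := DirectSum.lmap (compareRank ε ε' n) ∘ₗ L.d ∘ₗ
      DirectSum.lof R P (fun y => L.piece y) x)
    ((injective_iff_map_eq_zero _).2 fun a => hε'.injective_succ hx) (fun a => ?_) a
  obtain ⟨b, hb, hba⟩ := h a
  obtain ⟨c, hc⟩ := L'.belowOf_surjective hx ⟨b, hb⟩
  obtain rfl : DirectSum.lof R P (fun y => L'.piece y) x c = b := congrArg Subtype.val hc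
  exact ⟨c, hba.trans (e a).symm⟩

/-- By induction `compare` carries ∂a to a cycle of L' (in rank 0, to an element killed by the
augmentation), and exactness of L' supplies the primitive. -/
lemma d_compare (hε : L.IsAugmentation ε) (hε' : L'.IsAugmentation ε') (n : ℕ) :
    ∀ (x : P) (_ : grade ℕ x = n + 1) (a : L.piece x),
      L'.d (DirectSum.lof R P (fun y => L'.piece y) x (compare ε ε' x a)) =
        DirectSum.lmap (compare ε ε') (L.d (DirectSum.lof R P (fun y => L.piece y) x a)) := by
  induction n with
  | zero =>
    refine fun x hx => d_compare_of_exists hε hε' hx fun a => ?_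
    have ha := L.lof_mem_belowDeg le_rfl hx a
    let w : L.belowDeg x 0 := ⟨_, hε.lowers.d_mem ha⟩
    have hw : (ε.app x).hom w = 0 := (hε.exact_zero x w).2 ⟨_, ha, rfl⟩
    exact (hε'.exact_zero x (((belowMap (compare ε ε') 0).app x).hom w)).1
      ((congrArg (fun t => (t.app x).hom w) (compare_augmentation ε hε')).trans hw)
  | succ n ih =>
    refine fun x hx => d_compare_of_exists hε hε' hx fun a => ?_
    have ha := hε.lowers.d_mem (L.lof_mem_belowDeg le_rfl hx a)
    have comm (b : L.belowDeg x (n + 1)) : L'.d (DirectSum.lmap (compare ε ε') b.1) =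
        DirectSum.lmap (compare ε ε') (L.d b.1) := by
      revert b
      refine LinearMap.congr_fun
        (f := (L'.d ∘ₗ DirectSum.lmap (compare ε ε')) ∘ₗ (L.belowDeg x (n + 1)).subtype)
        (g := (DirectSum.lmap (compare ε ε') ∘ₗ L.d) ∘ₗ (L.belowDeg x (n + 1)).subtype)
        (belowDeg_hom_ext fun y h hy c => ?_)
      exact (congrArg L'.d (DirectSum.lmap_lof (compare ε ε') y c)).trans (ih y hy c)
    refine hε'.exact_succ x n _ (((belowMap (compare ε ε') (n + 1)).app x).hom ⟨_, ha⟩).2 ?_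
    refine (comm ⟨_, ha⟩).trans ((congrArg _ ?_).trans (map_zero _))
    exact LinearMap.congr_fun L.d_comp_d _

lemma compare_comm (hε : L.IsAugmentation ε) (hε' : L'.IsAugmentation ε') :
    DirectSum.lmap (compare ε ε') ∘ₗ L.d = L'.d ∘ₗ DirectSum.lmap (compare ε ε') := by
  refine DirectSum.linearMap_ext R fun x => LinearMap.ext fun a => ?_
  change DirectSum.lmap (compare ε ε') (L.d (DirectSum.lof R P _ x a)) =
    L'.d (DirectSum.lmap (compare ε ε') (DirectSum.lof R P _ x a))
  rw [DirectSum.lmap_lof]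
  rcases hx : grade ℕ x with - | n
  · rw [hε.lowers.d_lof_eq_zero hx, hε'.lowers.d_lof_eq_zero hx, map_zero]
  · exact (d_compare hε hε' n x hx a).symm

/-- By induction on rank: two values at `a` have the same augmentation in rank 0 and the same
boundary in higher rank, and these maps are injective on Λ'_x. -/
lemma hom_ext (hε : L.IsAugmentation ε) (hε' : L'.IsAugmentation ε') {f g : L ⟶ L'}
    (hf : belowMap (Hom.app f) 0 ≫ ε' = ε) (hg : belowMap (Hom.app g) 0 ≫ ε' = ε) : f = g := by
  have key (n : ℕ) : ∀ x, grade ℕ x = n → Hom.app f x = Hom.app g x := by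
    induction n with
    | zero =>
      intro x hx
      refine LinearMap.ext fun a => sub_eq_zero.1 (hε'.injective_zero hx ?_)
      have e (k : L ⟶ L') (hk : belowMap (Hom.app k) 0 ≫ ε' = ε) :
          (ε'.app x).hom (L'.belowOf le_rfl hx (Hom.app k x a)) =
            (ε.app x).hom (L.belowOf le_rfl hx a) :=
        (congrArg (ε'.app x).hom (belowOf_app (Hom.app k) le_rfl hx a)).symm.trans
          (congrArg (fun t => (t.app x).hom (L.belowOf le_rfl hx a)) hk)
      refine (congrArg (ε'.app x).hom (map_sub _ _ _)).trans ((map_sub _ _ _).trans ?_)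
      exact sub_eq_zero.2 ((e f hf).trans (e g hg).symm)
    | succ n ih =>
      intro x hx
      refine LinearMap.ext fun a => sub_eq_zero.1 (hε'.injective_succ hx ?_)
      have e (k : L ⟶ L') : L'.d (DirectSum.lof R P (fun y => L'.piece y) x (Hom.app k x a)) =
          DirectSum.lmap (Hom.app k) (L.d (DirectSum.lof R P (fun y => L.piece y) x a)) := by
        rw [← DirectSum.lmap_lof (Hom.app k)]
        exact (LinearMap.congr_fun (Hom.comm k) _).symm
      rw [map_sub, map_sub, e, e, sub_eq_zero]
      exact lmap_eq_of_mem_belowDeg ih (hε.lowers.d_mem (L.lof_mem_belowDeg le_rfl hx a))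
  exact Hom.ext (funext fun x => key _ x rfl)

/-- The comparison morphism between augmented modules. -/
noncomputable def compareHom (hε : L.IsAugmentation ε) (hε' : L'.IsAugmentation ε') : L ⟶ L' :=
  ⟨compare ε ε', compare_comm hε hε'⟩

lemma belowMap_comp {L'' : GradedDiffModule R P} (f : L ⟶ L') (g : L' ⟶ L'') (n : ℕ) :
    belowMap (Hom.app (f ≫ g)) n = belowMap (Hom.app f) n ≫ belowMap (Hom.app g) n := by
  refine NatTrans.ext (funext fun x => ModuleCat.hom_ext (LinearMap.ext fun a => Subtype.ext ?_))
  exact DFinsupp.ext fun y => rfl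

lemma belowMap_id (n : ℕ) : belowMap (Hom.app (𝟙 L)) n = 𝟙 (L.belowCopresheaf n) := by
  refine NatTrans.ext (funext fun x => ModuleCat.hom_ext (LinearMap.ext fun a => Subtype.ext ?_))
  exact DFinsupp.ext fun y => rfl

/-- The composite and the identity are both endomorphisms of L over G, hence equal by `hom_ext`. -/
lemma compareHom_comp (hε : L.IsAugmentation ε) (hε' : L'.IsAugmentation ε') :
    compareHom hε hε' ≫ compareHom hε' hε = 𝟙 L := by
  refine hom_ext hε hε ?_ ?_
  · rw [belowMap_comp, Category.assoc]
    exact (congrArg (_ ≫ ·) (compare_augmentation ε' hε)).trans (compare_augmentation ε hε')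
  · rw [belowMap_id, Category.id_comp]

/-- The comparison isomorphism between augmented modules. -/
noncomputable def compareIso (hε : L.IsAugmentation ε) (hε' : L'.IsAugmentation ε') : L ≅ L' where
  hom := compareHom hε hε'
  inv := compareHom hε' hε
  hom_inv_id := compareHom_comp hε hε'
  inv_hom_id := compareHom_comp hε' hε

end IsAugmentation
end GradedDiffModule

open GradedDiffModule

variable {R : Type} [CommRing R] {P : Type u} [PartialOrder P] [GradeOrder ℕ P] {G : CoPSh R P}

lemma CellularForm.existsUnique_iso (L L' : CellularForm G) :
    ∃! e : L.toGradedDiffModule ≅ L'.toGradedDiffModule,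
      H₀Map e.hom L.lowers L'.lowers ≫ L'.iso.hom = L.iso.hom := by
  refine ⟨IsAugmentation.compareIso L.isAugmentation L'.isAugmentation,
    (L.H₀Map_comp_iff L' _).2
      (IsAugmentation.compare_augmentation L.augmentation L'.isAugmentation), fun e he => ?_⟩
  exact Iso.ext (IsAugmentation.hom_ext L.isAugmentation L'.isAugmentation
    ((L.H₀Map_comp_iff L' _).1 he)
    (IsAugmentation.compare_augmentation L.augmentation L'.isAugmentation))

lemma isHomologicalCellular_iff [IsDedekindDomain R]
    (hG : ∀ x, Module.IsTorsionFree R (G.obj x)) :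
    IsHomologicalCellular G ↔ Nonempty (CellularForm G) :=
  ⟨fun h => ⟨(syzygyAugmentation_isAugmentation hG h).cellularForm⟩,
    fun ⟨L⟩ => L.isAugmentation.isHomologicalCellular hG⟩

end PosetCellular

theorem mainTheorem7 {P : Type u} [PartialOrder P] [GradeOrder ℕ P]
    (G : PosetCellular.CoPSh ℤ P) (hG : PosetCellular.CoPSh.IsFree G) :
    (PosetCellular.IsHomologicalCellular G ↔ Nonempty (PosetCellular.CellularForm G)) ∧
    ∀ L L' : PosetCellular.CellularForm G,
      ∃! e : L.toGradedDiffModule ≅ L'.toGradedDiffModule,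
        PosetCellular.GradedDiffModule.H₀Map e.hom L.lowers L'.lowers ≫ L'.iso.hom =
          L.iso.hom :=
  ⟨PosetCellular.isHomologicalCellular_iff fun x =>
    have := hG x
    inferInstance, fun L L' => L.existsUnique_iso L'⟩
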